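/- \textbf{The walk.} Let $H=\frac1{\sqrt2}\begin{pmatrix}1&1\\1&-1\end{pmatrix}$ and let $|1\rangle={}^T[1,0]$, $|{-1}\rangle={}^T[0,1]$. The $M$-coin quantum walk on $\mathbb Z$ has state space $\ell^2(\mathbb Z)\otimes(\mathbb C^2)^{\otimes M}$ with basis $|x,\xi_{M-1},\dots,\xi_0\rangle$, $x\in\mathbb Z$, $\xi_i\in\{1,-1\}$. In the step from time $t$ to $t+1$, with $j=t \bmod M$, first $H$ is applied to the $j$-th coin, and then $|x,\xi_{M-1},\dots,\xi_0\rangle$ is sent to $|x+\xi_j,\xi_{M-1},\dots,\xi_0\rangle$. The walk starts at the origin $x=0$ with coin state $\Phi_0$; if $\Phi_t(x)\in(\mathbb C^2)^{\otimes M}$ is the coin state at time $t$ and position $x$, then $P(X_t^{[M]}=x)=\|\Phi_t(x)\|^2$. Two initial coin states are considered. Case (A): $\Phi_0=\varphi_0^{\otimes M}$ with $\varphi_0={}^T[1/\sqrt2,\,i/\sqrt2]$. Case (B): $\Phi_0=\phi_{M-1}\otimes\cdots\otimes\phi_0$ where the $\phi_j$ are independent and equal to $|1\rangle$ or $|{-1}\rangle$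 with probability $1/2$ each. Let $\Rightarrow$ denote weak convergence, and take $t=dM$. \textbf{(1)} Let $M\ge1$ be fixed and $d\to\infty$. Then $X_t^{[M]}/t\Rightarrow Y^{[M]}$ in Case (A) and $X_t^{[M]}/t\Rightarrow Z^{[M]}$ in Case (B). With $x_j=x/|1-2j/M|$, $$\rho(x)=\frac{I_{(-1/\sqrt2,1/\sqrt2)}(x)}{\pi(1-x^2)\sqrt{1-2x^2}},\quad \mathcal P(x)=\frac{1+\sqrt{1-2x^2}}2,\quad \mathcal Q(x)=\frac{1-\sqrt{1-2x^2}}2,$$ the (generalized) densities of $Y^{[M]}$ and $Z^{[M]}$ are, respectively, $$f^{[M]}(x)=\sum_{\substack{0\le j\le M\\ 2j\ne M}}\binom Mj\frac{\rho(x_j)}{|1-2j/M|}\,\mathcal P(x_j)^{M-j}\mathcal Q(x_j)^{j}+c\,I_{(M\text{ even})}\,\delta_0,$$ $$g^{[M]}(x)=\Big(\frac12\Big)^{M}\sum_{\substack{0\le j\le M\\ 2j\ne M}}\binom Mj\frac{\rho(x_j)}{|1-2j/M|}+c'\,I_{(M\text{ even})}\,\delta_0,$$ where $\delta_0$ is the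 unit point mass at $0$ and, for even $M$, the constants $c,c'\ge0$ are determined by the requirement that the total mass be $1$ (for odd $M$ the total mass is $1$ without an atom). \textbf{(2)} Let $d\ge2$ be fixed and $M\to\infty$. Put $\widehat H(k)=\mathrm{diag}(e^{ik},e^{-ik})H$, $\widehat\Psi_d(k)=\widehat H(k)^d\varphi_0$, $D_k=i\,d/dk$, $$\mu_d(k)=\frac1d\big\langle\widehat\Psi_d(k),D_k\widehat\Psi_d(k)\big\rangle,\qquad \nu_d(k)=\frac1{2d}\mathrm{Tr}\big[\widehat H(k)^{-d}\,D_k^2\widehat H(k)^d\big].$$ Then $\mu_d(k)$ is real and $\nu_d(k)$ is real and nonnegative for all $k\in\mathbb R$; in Case (A), $X_t^{[M]}/t\Rightarrow Y_d$, and in Case (B), $X_t^{[M]}/\sqrt t\Rightarrow Z_d$, where $Y_d$ and $Z_d$ are real random variables with, for all $x\in\mathbb R$, $$P(Y_d\le x)=\int_{\{k\in[0,2\pi):\ \mu_d(k)\le x\}}\frac{dk}{2\pi},\qquad P(Z_d\le x)=\iint_{\{(k,u)\in[0,2\pi)\times\mathbb R:\ u\sqrt{\nu_d(k)}\le x\}}\frac{e^{-u^2/2}\,du\,dk}{(2\pi)^{3/2}}.$$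 -/

import Mathlib

open MeasureTheory ProbabilityTheory Filter Topology
open scoped ENNReal

noncomputable section

namespace MultiCoin

/-- The two-dimensional Hadamard matrix. Index `0` is chirality `1`, index `1` is chirality `-1`. -/
def hadamard : Matrix (Fin 2) (Fin 2) ℂ :=
  ((1 / Real.sqrt 2 : ℝ) : ℂ) • !![1, 1; 1, -1]

/-- The displacement belonging to a chirality. -/
def shift : Fin 2 → ℤ := ![1, -1]

/-- The coin space `(ℂ²)^{⊗ M}`, in coordinates with respect to the standard product basis. -/
abbrev CoinSpace (M : ℕ) : Type := EuclideanSpace ℂ (Fin M → Fin 2)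

/-- A state of the walk: the coin state at each position. -/
abbrev WalkState (M : ℕ) : Type := ℤ → CoinSpace M

/-- The coin flip: the Hadamard matrix acts on the `j`-th tensor factor. -/
def coinFlip {M : ℕ} (j : Fin M) (Φ : WalkState M) : WalkState M :=
  fun x => WithLp.toLp 2 fun ξ => ∑ a : Fin 2, hadamard (ξ j) a * Φ x (Function.update ξ j a)

/-- The shift: `|x, ξ⟩` is sent to `|x + ξ_j, ξ⟩`. -/
def shiftStep {M : ℕ} (j : Fin M) (Φ : WalkState M) : WalkState M :=
  fun x => WithLp.toLp 2 fun ξ => Φ (x - shift (ξ j)) ξ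

/-- The state at time `t`, the walk being started at the origin with coin state `φ`; at time `t`
the coin with number `t mod M` is used. (For `M = 0` there is no coin, and nothing moves.) -/
def walk {M : ℕ} (φ : CoinSpace M) : ℕ → WalkState M
  | 0 => fun x => if x = 0 then φ else 0
  | t + 1 =>
      if hM : 0 < M then
        shiftStep ⟨t % M, Nat.mod_lt t hM⟩ (coinFlip ⟨t % M, Nat.mod_lt t hM⟩ (walk φ t))
      else walk φ t

/-- The product state `φ ⊗ ⋯ ⊗ φ` of `M` coins. -/
def productState (M : ℕ) (φ : Fin 2 → ℂ) : CoinSpace M :=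
  WithLp.toLp 2 fun ξ => ∏ j, φ (ξ j)

/-- The one-coin state `ᵀ[1/√2, i/√2]`. -/
def phi0 : Fin 2 → ℂ :=
  ![((1 / Real.sqrt 2 : ℝ) : ℂ), Complex.I * ((1 / Real.sqrt 2 : ℝ) : ℂ)]

/-- The basis state `|η⟩`. -/
def basisState {M : ℕ} (η : Fin M → Fin 2) : CoinSpace M := EuclideanSpace.single η 1

section Normalization

lemma hadamard_normSq (u v : ℂ) :
    ∑ b : Fin 2, ‖hadamard b 0 * u + hadamard b 1 * v‖ ^ 2 = ‖u‖ ^ 2 + ‖v‖ ^ 2 := by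
  have h2 : Real.sqrt 2 * Real.sqrt 2 = 2 := Real.mul_self_sqrt (by norm_num)
  have h3 : (1 / Real.sqrt 2) * (1 / Real.sqrt 2) = 1 / 2 := by
    rw [div_mul_div_comm, h2]; norm_num
  set s : ℝ := 1 / Real.sqrt 2 with hs
  simp only [Fin.sum_univ_two, hadamard, Matrix.smul_apply, smul_eq_mul, ← hs]
  simp only [Complex.sq_norm, Complex.normSq_apply]
  simp
  linear_combination (2 * (u.re ^ 2 + u.im ^ 2 + v.re ^ 2 + v.im ^ 2)) * h3

lemma coinFlip_norm {M : ℕ} (j : Fin M) (Φ : WalkState M) (x : ℤ) :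
    ‖coinFlip j Φ x‖ ^ 2 = ‖Φ x‖ ^ 2 := by
  rw [EuclideanSpace.norm_sq_eq, EuclideanSpace.norm_sq_eq]
  rw [← (Equiv.funSplitAt j (Fin 2)).symm.sum_comp, ← (Equiv.funSplitAt j (Fin 2)).symm.sum_comp,
    Fintype.sum_prod_type_right, Fintype.sum_prod_type_right]
  refine Finset.sum_congr rfl fun g _ => ?_
  have hu : ∀ a b : Fin 2, Function.update ((Equiv.funSplitAt j (Fin 2)).symm (b, g)) j a
      = (Equiv.funSplitAt j (Fin 2)).symm (a, g) := by
    intro a b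
    funext i
    by_cases h : i = j
    · subst h; simp [Equiv.funSplitAt, Equiv.piSplitAt]
    · simp [Equiv.funSplitAt, Equiv.piSplitAt, h]
  have hj : ∀ b : Fin 2, (Equiv.funSplitAt j (Fin 2)).symm (b, g) j = b := by
    intro b; simp [Equiv.funSplitAt, Equiv.piSplitAt]
  simp only [coinFlip, hu, hj]
  rw [Fin.sum_univ_two (f := fun b => ‖Φ x ((Equiv.funSplitAt j (Fin 2)).symm (b, g))‖ ^ 2),
    ← hadamard_normSq]
  simp [Fin.sum_univ_two]

lemma normSq_eq_sum {M : ℕ} (v : CoinSpace M) :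
    ENNReal.ofReal (‖v‖ ^ 2) = ∑ ξ, ENNReal.ofReal (‖v ξ‖ ^ 2) := by
  rw [EuclideanSpace.norm_sq_eq, ENNReal.ofReal_sum_of_nonneg fun _ _ => by positivity]

lemma shiftStep_norm {M : ℕ} (j : Fin M) (Φ : WalkState M) :
    ∑' x, ENNReal.ofReal (‖shiftStep j Φ x‖ ^ 2) = ∑' x, ENNReal.ofReal (‖Φ x‖ ^ 2) := by
  simp only [normSq_eq_sum]
  rw [Summable.tsum_finsetSum fun _ _ => ENNReal.summable,
    Summable.tsum_finsetSum fun _ _ => ENNReal.summable]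
  refine Finset.sum_congr rfl fun ξ _ => ?_
  exact (Equiv.subRight (shift (ξ j))).tsum_eq fun x => ENNReal.ofReal (‖Φ x ξ‖ ^ 2)

/-- The total probability is `1` at all times. -/
lemma walk_norm {M : ℕ} (φ : CoinSpace M) (hφ : ‖φ‖ = 1) (t : ℕ) :
    ∑' x, ENNReal.ofReal (‖walk φ t x‖ ^ 2) = 1 := by
  induction t with
  | zero =>
    rw [tsum_eq_single 0]
    · simp [walk, hφ]
    · intro x hx; simp [walk, hx]
  | succ t ih =>
    rw [walk]
    split_ifs with hM
    · rw [shiftStep_norm]; simpa only [coinFlip_norm] using ih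
    · exact ih

lemma productState_norm (M : ℕ) : ‖productState M phi0‖ = 1 := by
  have h2 : Real.sqrt 2 * Real.sqrt 2 = 2 := Real.mul_self_sqrt (by norm_num)
  have h1 : ∑ a : Fin 2, ‖phi0 a‖ ^ 2 = 1 := by
    simp [phi0, Fin.sum_univ_two]
    norm_num
  have h : ‖productState M phi0‖ ^ 2 = 1 := by
    rw [EuclideanSpace.norm_sq_eq]
    simp only [productState, norm_prod, ← Finset.prod_pow]
    rw [← Fintype.prod_sum (fun (_ : Fin M) a => ‖phi0 a‖ ^ 2)]
    simp [h1]
  exact (pow_eq_one_iff_of_nonneg (norm_nonneg _) two_ne_zero).1 h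

lemma basisState_norm {M : ℕ} (η : Fin M → Fin 2) : ‖basisState η‖ = 1 := by
  simp [basisState]

end Normalization

/-- The distribution of the position at time `t`: `P(X_t = x) = ‖Φ_t(x)‖²`. -/
def position {M : ℕ} (φ : CoinSpace M) (hφ : ‖φ‖ = 1) (t : ℕ) : PMF ℤ :=
  ⟨fun x => ENNReal.ofReal (‖walk φ t x‖ ^ 2), walk_norm φ hφ t ▸ ENNReal.summable.hasSum⟩

/-- Case (A): the distribution of `X_t` for the initial qubit `φ₀ ⊗ ⋯ ⊗ φ₀`. -/
def positionA (M t : ℕ) : PMF ℤ := position (productState M phi0) (productState_norm M) t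

/-- Case (B): the distribution of `X_t` for a uniformly random basis state as initial qubit, i.e.
for independent fair choices of the `M` chiralities. -/
def positionB (M t : ℕ) : PMF ℤ :=
  (PMF.uniformOfFintype (Fin M → Fin 2)).bind fun η =>
    position (basisState η) (basisState_norm η) t

/-- The law of `X / s`, for an integer random variable `X` with distribution `p`. -/
def scaledLaw (p : PMF ℤ) (s : ℝ) : ProbabilityMeasure ℝ :=
  ⟨(p.map fun x : ℤ => (x : ℝ) / s).toMeasure, inferInstance⟩

/-- The limit density of the Hadamard walk. -/
def konno (x : ℝ) : ℝ :=
  Set.indicator (Set.Ioo (-(1 / Real.sqrt 2)) (1 / Real.sqrt 2))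
    (fun y => 1 / (Real.pi * (1 - y ^ 2) * Real.sqrt (1 - 2 * y ^ 2))) x

/-- `𝒫(x) = (1 + √(1 - 2x²)) / 2`. -/
def weightP (x : ℝ) : ℝ := (1 + Real.sqrt (1 - 2 * x ^ 2)) / 2

/-- `𝒬(x) = (1 - √(1 - 2x²)) / 2`. -/
def weightQ (x : ℝ) : ℝ := (1 - Real.sqrt (1 - 2 * x ^ 2)) / 2

/-- The factor `|1 - 2j/M|`. -/
def slope (M j : ℕ) : ℝ := |1 - 2 * (j : ℝ) / (M : ℝ)|

/-- The absolutely continuous part of the limit density for fixed `M`, case (A). -/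
def densityA (M : ℕ) (x : ℝ) : ℝ :=
  ∑ j ∈ (Finset.range (M + 1)).filter (fun j => 2 * j ≠ M),
    (M.choose j : ℝ) * (konno (x / slope M j) / slope M j) *
      weightP (x / slope M j) ^ (M - j) * weightQ (x / slope M j) ^ j

/-- The absolutely continuous part of the limit density for fixed `M`, case (B). -/
def densityB (M : ℕ) (x : ℝ) : ℝ :=
  (1 / 2 : ℝ) ^ M * ∑ j ∈ (Finset.range (M + 1)).filter (fun j => 2 * j ≠ M),
    (M.choose j : ℝ) * (konno (x / slope M j) / slope M j)

/-- The measure with density `f`, to which, if `M` is even, an atom at `0` is added that carries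
the mass missing to `1`. -/
def withAtom (M : ℕ) (f : ℝ → ℝ) : Measure ℝ :=
  volume.withDensity (fun x => ENNReal.ofReal (f x)) +
    (if Even M then 1 - ∫⁻ x, ENNReal.ofReal (f x) else 0) • Measure.dirac 0

/-- The limit distribution for fixed `M`, case (A). -/
def limitA (M : ℕ) : Measure ℝ := withAtom M (densityA M)

/-- The limit distribution for fixed `M`, case (B). -/
def limitB (M : ℕ) : Measure ℝ := withAtom M (densityB M)

/-- The operator `D_k = i d/dk`. -/
def Dk (f : ℝ → ℂ) (k : ℝ) : ℂ := Complex.I * deriv f k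

/-- `Ĥ(k) = diag(e^{ik}, e^{-ik}) H`. -/
def Hhat (k : ℝ) : Matrix (Fin 2) (Fin 2) ℂ :=
  Matrix.diagonal ![Complex.exp (Complex.I * k), Complex.exp (-(Complex.I * k))] * hadamard

/-- `Ψ̂_d(k) = Ĥ(k)^d φ₀`. -/
def psi (d : ℕ) (k : ℝ) : Fin 2 → ℂ := (Hhat k ^ d).mulVec phi0

/-- `⟨Ψ̂_d(k), D_k Ψ̂_d(k)⟩ / d`, the inner product being antilinear in the first variable. -/
def mu (d : ℕ) (k : ℝ) : ℂ :=
  (∑ a, starRingEnd ℂ (psi d k a) * Dk (fun l => psi d l a) k) / d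

/-- `Tr[Ĥ(k)^{-d} · D_k² Ĥ(k)^d] / (2d)`. -/
def nu (d : ℕ) (k : ℝ) : ℂ :=
  ((Hhat k ^ d)⁻¹ * Matrix.of fun a b => Dk (Dk fun l => (Hhat l ^ d) a b) k).trace / (2 * d)

end MultiCoin

end

namespace MultiCoin

/-! ### Fourier analysis of the walk -/

/-! In Fourier space a step with coin `j` multiplies the `j`-th tensor factor by `Ĥ(k)` and leaves
the others alone. A product state therefore stays a product for every `k`, and at time `dM` every
factor carries `Ĥ(k)^d` (`fourier_walk_mul`). Parseval against a translate by `θ` (`parseval_shift`)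
writes the characteristic function of the position as the mean over `k ∈ [0, 2π)` of the `M`-th
power of a single number: the overlap `⟨Ĥ(k)^d φ₀, Ĥ(k+θ)^d φ₀⟩` in case (A), half the trace of
`Ĥ(k)^{-d} Ĥ(k+θ)^d` in case (B). By unitarity these numbers have modulus at most 1, so Lévy's
continuity theorem and dominated convergence reduce every claim to a pointwise limit in `k`.

For `d` fixed and `M → ∞`, that limit is `(1 + z/M + o(1/M))^M → e^z`. The overlap attains its
maximal modulus 1 at `θ = 0`, so its derivative there is imaginary and only a phase given by
`μ_d(k)` survives. The half trace is moreover real, so its derivative vanishes, and the second order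
term on the scale `√t` gives `exp(-θ² ν_d(k) / 2)`.

For `M` fixed and `d → ∞`, write the eigenvalues as `e^{iα}` and `-e^{-iα}` with `sin α(k) = sin k /
√2`. Then `Ĥ(k)^{-d} Ĥ(k + c/d)^d` tends to the sum of the two spectral projections with phases
`e^{±icα'(k)}` (`tendsto_star_Hhat_pow_mul_Hhat_pow`). Expanding the `M`-th power binomially gives
the velocities `(1 - 2j/M) x`. The substitution `x = -α'(k)` turns the uniform law on `(0, π)` into
Konno's density (`deriv_mul_konno`) and the eigenvector weights of `φ₀` into `𝒫` and `𝒬`. The term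
of velocity zero, `j = M/2`, is the atom. -/

lemma Hhat_apply (k : ℝ) (b a : Fin 2) :
    Hhat k b a = Complex.exp (Complex.I * k * shift b) * hadamard b a := by
  rw [Hhat, Matrix.diagonal_mul]
  fin_cases b <;> simp [shift]

/-- Propagation is at most one site per step. The resulting finite support turns the Fourier series
below into finite sums. -/
lemma walk_eq_zero {M : ℕ} (φ : CoinSpace M) (t : ℕ) (x : ℤ) (hx : (t : ℤ) < |x|) :
    walk φ t x = 0 := by
  induction t generalizing x with
  | zero =>
    have : x ≠ 0 := by rintro rfl; simp at hx
    simp [walk, this]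
  | succ t ih =>
    rw [walk]
    split_ifs with hM
    · ext ξ
      have hs : ∀ b : Fin 2, |shift b| = 1 := by intro b; fin_cases b <;> simp [shift]
      have h0 : walk φ t (x - shift (ξ ⟨t % M, Nat.mod_lt t hM⟩)) = 0 := by
        apply ih
        have h1 := hs (ξ ⟨t % M, Nat.mod_lt t hM⟩)
        have h2 := abs_sub_abs_le_abs_sub x (shift (ξ ⟨t % M, Nat.mod_lt t hM⟩))
        push_cast at hx
        omega
      simp [shiftStep, coinFlip, h0]
    · apply ih
      push_cast at hx
      omega

/-- The Fourier transform of a state of the walk. -/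
noncomputable def fourier {M : ℕ} (Φ : WalkState M) (k : ℝ) (ξ : Fin M → Fin 2) : ℂ :=
  ∑' x : ℤ, Complex.exp (Complex.I * k * x) * Φ x ξ

lemma fourier_shiftStep {M : ℕ} (j : Fin M) (Φ : WalkState M) (k : ℝ) (ξ : Fin M → Fin 2) :
    fourier (shiftStep j Φ) k ξ
      = Complex.exp (Complex.I * k * shift (ξ j)) * fourier Φ k ξ := by
  -- Translating the summation index is valid for arbitrary series, so no finiteness is needed here,
  -- in contrast to the coin flip.
  rw [fourier, fourier, ← tsum_mul_left, ← (Equiv.subRight (shift (ξ j))).tsum_eq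
    (fun x : ℤ => Complex.exp (Complex.I * k * shift (ξ j)) *
      (Complex.exp (Complex.I * k * x) * Φ x ξ))]
  refine tsum_congr fun x => ?_
  simp only [shiftStep, Equiv.subRight_apply]
  rw [← mul_assoc, ← Complex.exp_add]
  congr 2
  push_cast
  ring

lemma fourier_coinFlip {M : ℕ} (j : Fin M) (Φ : WalkState M) (hΦ : Φ.support.Finite)
    (k : ℝ) (ξ : Fin M → Fin 2) :
    fourier (coinFlip j Φ) k ξ
      = ∑ a : Fin 2, hadamard (ξ j) a * fourier Φ k (Function.update ξ j a) := by
  simp only [fourier, ← tsum_mul_left]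
  rw [← Summable.tsum_finsetSum]
  · refine tsum_congr fun x => ?_
    simp only [coinFlip, Finset.mul_sum]
    exact Finset.sum_congr rfl fun a _ => by ring
  · intro a _
    refine summable_of_hasFiniteSupport (hΦ.subset fun x hx => ?_)
    simp only [Function.mem_support] at hx ⊢
    rintro h
    simp [h] at hx

lemma walk_support_finite {M : ℕ} (φ : CoinSpace M) (t : ℕ) :
    (Function.support (walk φ t)).Finite := by
  refine (Set.finite_Icc (-(t : ℤ)) t).subset fun x hx => ?_
  by_contra h
  refine hx (walk_eq_zero φ t x ?_)
  rw [Set.mem_Icc, ← abs_le] at h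
  omega

/-- Step `t` touches only the factor `t % M`, on which the phase of the shift and the Hadamard
entries combine to `Ĥ(k)`. The exponent counts how often coin `j` has been used before time `t`. The
factors may differ from coin to coin, as case (B) requires. -/
lemma fourier_walk {M : ℕ} (f : Fin M → Fin 2 → ℂ) (φ : CoinSpace M)
    (hφ : ∀ ξ, φ ξ = ∏ j, f j (ξ j)) (t : ℕ) (k : ℝ) (ξ : Fin M → Fin 2) :
    fourier (walk φ t) k ξ
      = ∏ j : Fin M, (Hhat k ^ (t.count (· ≡ (j : ℕ) [MOD M]))).mulVec (f j) (ξ j) := by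
  induction t generalizing ξ with
  | zero =>
    rw [fourier, tsum_eq_single 0]
    · simp [walk, hφ]
    · intro x hx; simp [walk, hx]
  | succ t ih =>
    rcases Nat.eq_zero_or_pos M with rfl | hM
    · simpa [walk] using ih ξ
    rw [walk, dif_pos hM, fourier_shiftStep, fourier_coinFlip _ _ (walk_support_finite φ t)]
    set i : Fin M := ⟨t % M, Nat.mod_lt t hM⟩ with hi
    simp only [ih]
    rw [← Finset.mul_prod_erase _ _ (Finset.mem_univ i)]
    have hne : ∀ j ∈ Finset.univ.erase i, ¬ t ≡ (j : ℕ) [MOD M] := by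
      intro j hj h
      apply (Finset.mem_erase.1 hj).1
      ext
      rw [hi, ← Nat.mod_eq_of_lt j.2]
      exact h.symm
    have hcount : (t + 1).count (· ≡ (i : ℕ) [MOD M]) = t.count (· ≡ (i : ℕ) [MOD M]) + 1 := by
      rw [Nat.count_succ, if_pos]
      simp [hi, Nat.ModEq]
    rw [hcount, pow_succ', ← Matrix.mulVec_mulVec, Matrix.mulVec, dotProduct, Finset.mul_sum,
      Finset.sum_mul]
    refine Finset.sum_congr rfl fun a _ => ?_
    rw [← Finset.mul_prod_erase _ _ (Finset.mem_univ i), Function.update_self, Hhat_apply]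
    have : ∀ j ∈ Finset.univ.erase i,
        (Hhat k ^ (t.count (· ≡ (j : ℕ) [MOD M]))).mulVec (f j) (Function.update ξ i a j)
        = (Hhat k ^ ((t + 1).count (· ≡ (j : ℕ) [MOD M]))).mulVec (f j) (ξ j) := by
      intro j hj
      rw [Function.update_of_ne (Finset.mem_erase.1 hj).1, Nat.count_succ, if_neg (hne j hj),
        add_zero]
    rw [Finset.prod_congr rfl this]
    ring

lemma fourier_walk_mul {M : ℕ} (f : Fin M → Fin 2 → ℂ) (φ : CoinSpace M)
    (hφ : ∀ ξ, φ ξ = ∏ j, f j (ξ j)) (d : ℕ) (k : ℝ) (ξ : Fin M → Fin 2) :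
    fourier (walk φ (d * M)) k ξ = ∏ j : Fin M, (Hhat k ^ d).mulVec (f j) (ξ j) := by
  rw [fourier_walk f φ hφ]
  refine Finset.prod_congr rfl fun j _ => ?_
  have hM : 0 < M := j.pos
  rw [Nat.count_modEq_card _ hM]
  simp [hM]

lemma integral_exp_int_mul (n : ℤ) :
    ∫ k in (0 : ℝ)..(2 * Real.pi), Complex.exp (Complex.I * k * n)
      = if n = 0 then (2 * Real.pi : ℂ) else 0 := by
  split_ifs with hn
  · simp [hn]
  · have hc : Complex.I * n ≠ 0 := by simp [hn]
    have : ∀ k : ℝ, Complex.I * k * n = Complex.I * n * k := fun k => by ring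
    simp only [this]
    rw [integral_exp_mul_complex hc]
    have h2 : Complex.exp (Complex.I * n * ((2 * Real.pi : ℝ) : ℂ)) = 1 := by
      rw [Complex.exp_eq_one_iff]
      exact ⟨n, by push_cast; ring⟩
    rw [h2]
    simp

/-- Orthogonality of the exponentials kills all terms with `x ≠ y`, while the translate by `θ`
leaves the phase `e^{iθx}` on the diagonal. Applied to amplitudes, this yields a characteristic
function directly. -/
lemma parseval_shift (g : ℤ → ℂ) (hg : g.support.Finite) (θ : ℝ) :
    ∫ k in (0 : ℝ)..(2 * Real.pi),
      (starRingEnd ℂ (∑' x : ℤ, Complex.exp (Complex.I * k * x) * g x)) *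
        (∑' x : ℤ, Complex.exp (Complex.I * (k + θ : ℝ) * x) * g x)
      = 2 * Real.pi * ∑' x : ℤ, Complex.exp (Complex.I * θ * x) * ((‖g x‖ ^ 2 : ℝ) : ℂ) := by
  have hS : ∀ c : ℤ → ℂ, ∀ x ∉ hg.toFinset, c x * g x = 0 := by
    intro c x hx
    simp only [Set.Finite.mem_toFinset, Function.mem_support, not_not] at hx
    simp [hx]
  have hS' : ∀ x ∉ hg.toFinset, Complex.exp (Complex.I * θ * x) * ((‖g x‖ ^ 2 : ℝ) : ℂ) = 0 := by
    intro x hx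
    simp only [Set.Finite.mem_toFinset, Function.mem_support, not_not] at hx
    simp [hx]
  rw [tsum_eq_sum hS']
  have h : ∀ k : ℝ, (starRingEnd ℂ (∑' x : ℤ, Complex.exp (Complex.I * k * x) * g x)) *
        (∑' x : ℤ, Complex.exp (Complex.I * (k + θ : ℝ) * x) * g x)
      = ∑ x ∈ hg.toFinset, ∑ y ∈ hg.toFinset, Complex.exp (Complex.I * θ * y) *
          (starRingEnd ℂ (g x) * g y) * Complex.exp (Complex.I * k * (y - x : ℤ)) := by
    intro k
    rw [tsum_eq_sum (hS _), tsum_eq_sum (hS _), map_sum, Finset.sum_mul_sum]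
    refine Finset.sum_congr rfl fun x _ => Finset.sum_congr rfl fun y _ => ?_
    rw [map_mul, ← Complex.exp_conj]
    have e : Complex.exp (Complex.I * (k + θ : ℝ) * y)
        = Complex.exp (Complex.I * θ * y) * Complex.exp (Complex.I * k * y) := by
      rw [← Complex.exp_add]; congr 1; push_cast; ring
    have e' : Complex.exp (Complex.I * k * (y - x : ℤ)) = Complex.exp (Complex.I * k * y) *
        Complex.exp ((starRingEnd ℂ) (Complex.I * k * x)) := by
      rw [← Complex.exp_add]; congr 1; simp; ring
    rw [e, e']
    ring
  simp only [h]
  rw [intervalIntegral.integral_finsetSum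
    (fun _ _ => Continuous.intervalIntegrable (by fun_prop) _ _), Finset.mul_sum]
  refine Finset.sum_congr rfl fun x hx => ?_
  rw [intervalIntegral.integral_finsetSum
    (fun _ _ => Continuous.intervalIntegrable (by fun_prop) _ _), Finset.sum_eq_single x]
  · rw [intervalIntegral.integral_const_mul, integral_exp_int_mul]
    simp only [sub_self, if_true]
    rw [Complex.conj_mul']
    push_cast
    ring
  · intro y _ hy
    rw [intervalIntegral.integral_const_mul, integral_exp_int_mul, if_neg (sub_ne_zero.2 hy),
      mul_zero]
  · exact fun h => absurd hx h

/-- The inner product of `Ĥ(k)^d φ` and `Ĥ(l)^d φ`. -/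
noncomputable def overlap (d : ℕ) (φ : Fin 2 → ℂ) (k l : ℝ) : ℂ :=
  ∑ a, starRingEnd ℂ ((Hhat k ^ d).mulVec φ a) * (Hhat l ^ d).mulVec φ a

lemma continuous_Hhat_pow (d : ℕ) : Continuous fun k : ℝ => Hhat k ^ d := by
  refine Continuous.pow ?_ d
  refine continuous_matrix fun a b => ?_
  simp only [Hhat_apply]
  fun_prop

lemma continuous_Hhat_pow_mulVec (d : ℕ) (φ : Fin 2 → ℂ) (a : Fin 2) :
    Continuous fun k : ℝ => (Hhat k ^ d).mulVec φ a :=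
  (continuous_pi_iff (f := fun k : ℝ => (Hhat k ^ d).mulVec φ)).1
    ((continuous_Hhat_pow d).matrix_mulVec continuous_const) a

/-- Parseval applies to each coin coordinate `ξ`. Since the transform is a product over the coins,
the sum over all `ξ` factorizes into one inner product per coin. -/
lemma tsum_walk_mul {M : ℕ} (f : Fin M → Fin 2 → ℂ) (φ : CoinSpace M)
    (hφ : ∀ ξ, φ ξ = ∏ j, f j (ξ j)) (d : ℕ) (θ : ℝ) :
    ∑' x : ℤ, Complex.exp (Complex.I * θ * x) * ((‖walk φ (d * M) x‖ ^ 2 : ℝ) : ℂ)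
      = (2 * Real.pi)⁻¹ * ∫ k in (0 : ℝ)..(2 * Real.pi), ∏ j, overlap d (f j) k (k + θ) := by
  have hfin : ∀ ξ, (Function.support fun x => walk φ (d * M) x ξ).Finite := by
    intro ξ
    refine (walk_support_finite φ (d * M)).subset fun x hx h => hx ?_
    simp [h]
  have h1 : ∀ k, ∏ j, overlap d (f j) k (k + θ)
      = ∑ ξ, starRingEnd ℂ (fourier (walk φ (d * M)) k ξ) *
          fourier (walk φ (d * M)) (k + θ) ξ := by
    intro k
    simp only [overlap, fourier_walk_mul f φ hφ, map_prod, ← Finset.prod_mul_distrib]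
    rw [Fintype.prod_sum]
  have hcont : ∀ ξ, Continuous fun k => fourier (walk φ (d * M)) k ξ := by
    intro ξ
    simp only [fourier_walk_mul f φ hφ]
    exact continuous_finsetProd _ fun j _ => continuous_Hhat_pow_mulVec d (f j) (ξ j)
  simp only [h1]
  have hcont' : ∀ ξ, Continuous fun k => starRingEnd ℂ (fourier (walk φ (d * M)) k ξ) *
      fourier (walk φ (d * M)) (k + θ) ξ := fun ξ =>
    (Complex.continuous_conj.comp (hcont ξ)).mul
      ((hcont ξ).comp (f := fun k : ℝ => k + θ) (by fun_prop))
  rw [intervalIntegral.integral_finsetSum fun ξ _ => (hcont' ξ).intervalIntegrable _ _]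
  simp only [fourier, parseval_shift _ (hfin _)]
  have hpi : (((2 * Real.pi)⁻¹ : ℝ) : ℂ) * (2 * Real.pi) = 1 := by
    have : (Real.pi : ℂ) ≠ 0 := by exact_mod_cast Real.pi_ne_zero
    push_cast
    field_simp
  rw [← Finset.mul_sum, ← mul_assoc, hpi, one_mul,
    ← Summable.tsum_finsetSum]
  · refine tsum_congr fun x => ?_
    rw [EuclideanSpace.norm_sq_eq]
    push_cast
    rw [Finset.mul_sum]
  · intro ξ _
    refine summable_of_hasFiniteSupport ((hfin ξ).subset fun x hx h => hx ?_)
    simp only at h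
    simp [h]

lemma charFun_scaledLaw (p : PMF ℤ) (s θ : ℝ) :
    charFun (scaledLaw p s : Measure ℝ) θ
      = ∑' x : ℤ, ((p x).toReal : ℂ) * Complex.exp (Complex.I * (θ / s : ℝ) * x) := by
  rw [charFun_apply_real]
  simp only [scaledLaw, ProbabilityMeasure.coe_mk]
  rw [← PMF.toMeasure_map _ _ (measurable_of_countable _),
    integral_map (measurable_of_countable _).aemeasurable (by fun_prop)]
  have hb : ∀ x : ℤ, Complex.exp (θ * ((x : ℝ) / s : ℝ) * Complex.I)
      = Complex.exp (Complex.I * (θ / s : ℝ) * x) := by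
    intro x; congr 1; push_cast; ring
  simp only [hb]
  rw [PMF.integral_eq_tsum]
  · simp
  · refine Integrable.of_bound (measurable_of_countable _).aestronglyMeasurable 1
      (ae_of_all _ fun x => le_of_eq ?_)
    have : Complex.I * ((θ / s : ℝ) : ℂ) * (x : ℂ) = ((θ / s * x : ℝ) : ℂ) * Complex.I := by
      push_cast; ring
    rw [this, Complex.norm_exp_ofReal_mul_I]

lemma charFun_position {M : ℕ} (f : Fin M → Fin 2 → ℂ) (φ : CoinSpace M) (hn : ‖φ‖ = 1)
    (hφ : ∀ ξ, φ ξ = ∏ j, f j (ξ j)) (d : ℕ) (θ : ℝ) :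
    ∑' x : ℤ, ((position φ hn (d * M) x).toReal : ℂ) * Complex.exp (Complex.I * θ * x)
      = (2 * Real.pi)⁻¹ * ∫ k in (0 : ℝ)..(2 * Real.pi), ∏ j, overlap d (f j) k (k + θ) := by
  rw [← tsum_walk_mul f φ hφ]
  refine tsum_congr fun x => ?_
  rw [mul_comm]
  congr 2
  exact ENNReal.toReal_ofReal (by positivity)

lemma continuous_overlap (d : ℕ) (φ : Fin 2 → ℂ) :
    Continuous fun p : ℝ × ℝ => overlap d φ p.1 p.2 := by
  have h := continuous_Hhat_pow_mulVec d φ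
  refine continuous_finsetSum _ fun a _ => ?_
  exact (Complex.continuous_conj.comp ((h a).comp continuous_fst)).mul
    ((h a).comp continuous_snd)

/-- Half the trace of `Ĥ(k)^{-d} Ĥ(l)^d`. -/
noncomputable def meanOverlap (d : ℕ) (k l : ℝ) : ℂ :=
  (1 / 2) * ∑ b, overlap d (Pi.single b 1) k l

lemma continuous_meanOverlap (d : ℕ) :
    Continuous fun p : ℝ × ℝ => meanOverlap d p.1 p.2 :=
  continuous_const.mul (continuous_finsetSum _ fun _ _ => continuous_overlap d _)

lemma charFun_positionA (M d : ℕ) (s θ : ℝ) :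
    charFun (scaledLaw (positionA M (d * M)) s : Measure ℝ) θ
      = (2 * Real.pi)⁻¹ * ∫ k in (0 : ℝ)..(2 * Real.pi), overlap d phi0 k (k + θ / s) ^ M := by
  rw [charFun_scaledLaw, positionA, charFun_position (fun _ => phi0) _ _ (fun ξ => rfl)]
  simp

/-- The coins are independent, so averaging the product of overlaps over all basis states is the
product of the averages over a single coin. -/
lemma charFun_positionB (M d : ℕ) (s θ : ℝ) :
    charFun (scaledLaw (positionB M (d * M)) s : Measure ℝ) θ
      = (2 * Real.pi)⁻¹ * ∫ k in (0 : ℝ)..(2 * Real.pi), meanOverlap d k (k + θ / s) ^ M := by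
  have hbind : ∀ x : ℤ, ((positionB M (d * M) x).toReal : ℂ)
      = ∑ η : Fin M → Fin 2, ((1 / 2 : ℂ) ^ M *
          ((position (basisState η) (basisState_norm η) (d * M) x).toReal : ℂ)) := by
    intro x
    rw [positionB, PMF.bind_apply, tsum_fintype, ENNReal.toReal_sum]
    · push_cast
      refine Finset.sum_congr rfl fun η _ => ?_
      simp [PMF.uniformOfFintype_apply]
    · intro η _
      exact ENNReal.mul_ne_top (PMF.apply_ne_top _ _) (PMF.apply_ne_top _ _)
  have hbasis : ∀ η ξ : Fin M → Fin 2,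
      basisState η ξ = ∏ j, (Pi.single (η j) 1 : Fin 2 → ℂ) (ξ j) := by
    intro η ξ
    simp only [basisState, PiLp.single_apply, Pi.single_apply]
    split_ifs with h
    · simp [h]
    · obtain ⟨j, hj⟩ := Function.ne_iff.1 h
      rw [eq_comm, Finset.prod_eq_zero (Finset.mem_univ j)]
      simp [hj]
  rw [charFun_scaledLaw]
  have hterm : ∀ x : ℤ, ((positionB M (d * M) x).toReal : ℂ) *
      Complex.exp (Complex.I * (θ / s : ℝ) * x) = ∑ η : Fin M → Fin 2, ((1 / 2 : ℂ) ^ M *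
        (((position (basisState η) (basisState_norm η) (d * M) x).toReal : ℂ) *
          Complex.exp (Complex.I * (θ / s : ℝ) * x))) := by
    intro x
    rw [hbind, Finset.sum_mul]
    exact Finset.sum_congr rfl fun η _ => mul_assoc _ _ _
  simp only [hterm]
  rw [Summable.tsum_finsetSum]
  · have hη : ∀ η : Fin M → Fin 2, ∑' x : ℤ, (1 / 2 : ℂ) ^ M *
        (((position (basisState η) (basisState_norm η) (d * M) x).toReal : ℂ) *
          Complex.exp (Complex.I * (θ / s : ℝ) * x)) = (1 / 2 : ℂ) ^ M * ((2 * Real.pi)⁻¹ *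
        ∫ k in (0 : ℝ)..(2 * Real.pi),
          ∏ j, overlap d (Pi.single (η j) 1) k (k + θ / s)) := by
      intro η
      rw [tsum_mul_left, charFun_position _ _ _ (hbasis η)]
    simp only [hη]
    rw [← Finset.mul_sum, ← Finset.mul_sum, ← mul_assoc, mul_comm ((1 / 2 : ℂ) ^ M), mul_assoc,
      ← intervalIntegral.integral_finsetSum, ← intervalIntegral.integral_const_mul]
    · congr 1
      refine intervalIntegral.integral_congr fun k _ => ?_
      simp only [meanOverlap, mul_pow]
      rw [← Fintype.prod_sum
        (fun (_ : Fin M) b => overlap d (Pi.single b 1) k (k + θ / s))]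
      simp
    · intro η _
      refine Continuous.intervalIntegrable (continuous_finsetProd _ fun j _ => ?_) _ _
      exact (continuous_overlap d _).comp (f := fun k : ℝ => (k, k + θ / s)) (by fun_prop)
  · intro η _
    refine Summable.mul_left _ (summable_of_hasFiniteSupport
      ((walk_support_finite (basisState η) (d * M)).subset fun x hx h => hx ?_))
    have : position (basisState η) (basisState_norm η) (d * M) x = 0 := by
      change ENNReal.ofReal (‖walk (basisState η) (d * M) x‖ ^ 2) = 0
      rw [h]; simp
    simp [this]

/-! ### Unitarity, smoothness and derivatives of the overlaps -/

lemma Hhat_mem_unitaryGroup (k : ℝ) : Hhat k ∈ Matrix.unitaryGroup (Fin 2) ℂ := by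
  have hH : hadamard ∈ Matrix.unitaryGroup (Fin 2) ℂ := by
    have h2 : ((Real.sqrt 2 : ℝ) : ℂ) * ((Real.sqrt 2 : ℝ) : ℂ) = 2 := by
      rw [← Complex.ofReal_mul, Real.mul_self_sqrt (by norm_num)]; norm_num
    have h0 : ((Real.sqrt 2 : ℝ) : ℂ) ≠ 0 := by
      intro h; rw [h] at h2; norm_num at h2
    rw [Matrix.mem_unitaryGroup_iff]
    ext a b
    fin_cases a <;> fin_cases b <;>
      simp [hadamard, Matrix.mul_apply, Fin.sum_univ_two, Matrix.star_apply] <;>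
      field_simp <;> rw [sq, h2] <;> norm_num
  have hD : Matrix.diagonal ![Complex.exp (Complex.I * k), Complex.exp (-(Complex.I * k))]
      ∈ Matrix.unitaryGroup (Fin 2) ℂ := by
    rw [Matrix.mem_unitaryGroup_iff, Matrix.star_eq_conjTranspose, Matrix.diagonal_conjTranspose,
      Matrix.diagonal_mul_diagonal, ← Matrix.diagonal_one]
    congr 1
    ext a
    fin_cases a <;> simp [← Complex.exp_conj, ← Complex.exp_add]
  exact mul_mem hD hH

lemma Hhat_pow_mem_unitaryGroup (d : ℕ) (k : ℝ) :
    Hhat k ^ d ∈ Matrix.unitaryGroup (Fin 2) ℂ :=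
  pow_mem (Hhat_mem_unitaryGroup k) d

lemma overlap_eq_dotProduct (d : ℕ) (φ : Fin 2 → ℂ) (k l : ℝ) :
    overlap d φ k l = star φ ⬝ᵥ ((star (Hhat k ^ d) * Hhat l ^ d).mulVec φ) := by
  rw [← Matrix.mulVec_mulVec, Matrix.dotProduct_mulVec, Matrix.star_eq_conjTranspose,
    ← Matrix.star_mulVec]
  rfl

lemma overlap_self (d : ℕ) (φ : Fin 2 → ℂ) (k : ℝ) :
    overlap d φ k k = ((∑ a, ‖φ a‖ ^ 2 : ℝ) : ℂ) := by
  rw [overlap_eq_dotProduct, Matrix.mem_unitaryGroup_iff'.1 (Hhat_pow_mem_unitaryGroup d k),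
    Matrix.one_mulVec]
  simp [dotProduct, Complex.conj_mul']

lemma sum_norm_sq_Hhat_pow_mulVec (d : ℕ) (φ : Fin 2 → ℂ) (k : ℝ) :
    ∑ a, ‖(Hhat k ^ d).mulVec φ a‖ ^ 2 = ∑ a, ‖φ a‖ ^ 2 := by
  have h := overlap_self d φ k
  simp only [overlap, Complex.conj_mul'] at h
  exact_mod_cast h

lemma norm_overlap_le (d : ℕ) (φ : Fin 2 → ℂ) (k l : ℝ) :
    ‖overlap d φ k l‖ ≤ ∑ a, ‖φ a‖ ^ 2 := by
  have h1 := sum_norm_sq_Hhat_pow_mulVec d φ k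
  have h2 := sum_norm_sq_Hhat_pow_mulVec d φ l
  calc ‖overlap d φ k l‖
      ≤ ∑ a, (‖(Hhat k ^ d).mulVec φ a‖ ^ 2 + ‖(Hhat l ^ d).mulVec φ a‖ ^ 2) / 2 := by
        refine (norm_sum_le _ _).trans (Finset.sum_le_sum fun a _ => ?_)
        rw [norm_mul, Complex.norm_conj]
        -- The inequality `ab ≤ (a² + b²)/2` can replace Cauchy–Schwarz because both vectors have
        -- the norm of `φ`.
        nlinarith [sq_nonneg (‖(Hhat k ^ d).mulVec φ a‖ - ‖(Hhat l ^ d).mulVec φ a‖)]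
    _ = ∑ a, ‖φ a‖ ^ 2 := by
        rw [← Finset.sum_div, Finset.sum_add_distrib, h1, h2]; ring

lemma sum_norm_sq_phi0 : ∑ a, ‖phi0 a‖ ^ 2 = 1 := by
  simp [phi0, Fin.sum_univ_two]
  norm_num

lemma sum_norm_sq_single (b : Fin 2) : ∑ a, ‖(Pi.single b 1 : Fin 2 → ℂ) a‖ ^ 2 = 1 := by
  fin_cases b <;> simp [Fin.sum_univ_two]

lemma meanOverlap_eq_trace (d : ℕ) (k l : ℝ) :
    meanOverlap d k l = 1 / 2 * (star (Hhat k ^ d) * Hhat l ^ d).trace := by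
  simp only [meanOverlap, overlap_eq_dotProduct, Fin.sum_univ_two, Matrix.trace]
  simp [dotProduct, Matrix.mulVec_single, Fin.sum_univ_two]

lemma meanOverlap_self (d : ℕ) (k : ℝ) : meanOverlap d k k = 1 := by
  simp only [meanOverlap, overlap_self, sum_norm_sq_single]
  norm_num

lemma norm_meanOverlap_le (d : ℕ) (k l : ℝ) : ‖meanOverlap d k l‖ ≤ 1 := by
  have h : ∀ b, ‖overlap d (Pi.single b 1) k l‖ ≤ 1 := fun b =>
    (norm_overlap_le d _ k l).trans_eq (sum_norm_sq_single b)
  rw [meanOverlap, norm_mul, Fin.sum_univ_two]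
  have := norm_add_le (overlap d (Pi.single 0 1) k l) (overlap d (Pi.single 1 1) k l)
  have h0 := h 0
  have h1 := h 1
  norm_num
  linarith

lemma det_Hhat (k : ℝ) : (Hhat k).det = -1 := by
  have h2 : ((Real.sqrt 2 : ℝ) : ℂ) * ((Real.sqrt 2 : ℝ) : ℂ) = 2 := by
    rw [← Complex.ofReal_mul, Real.mul_self_sqrt (by norm_num)]; norm_num
  have h0 : ((Real.sqrt 2 : ℝ) : ℂ) ≠ 0 := by
    intro h; rw [h] at h2; norm_num at h2
  rw [Hhat, Matrix.det_mul, Matrix.det_diagonal, hadamard, Matrix.det_fin_two]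
  simp [Fin.prod_univ_two, ← Complex.exp_add]
  field_simp
  rw [sq, h2]
  norm_num

/-- A trace of an element of `SU(2)` is real. -/
lemma trace_im_of_mem_specialUnitary (W : Matrix (Fin 2) (Fin 2) ℂ)
    (hW : W ∈ Matrix.unitaryGroup (Fin 2) ℂ) (hdet : W.det = 1) : W.trace.im = 0 := by
  -- In determinant one the adjugate is the inverse. Its upper left entry shows that the two
  -- diagonal entries are complex conjugates.
  have h1 : W.adjugate = star W := by
    calc W.adjugate = star W * W * W.adjugate := by
          rw [Matrix.mem_unitaryGroup_iff'.1 hW, one_mul]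
      _ = star W := by rw [mul_assoc, Matrix.mul_adjugate, hdet, one_smul, mul_one]
  have h2 := congrFun (congrFun h1 0) 0
  rw [Matrix.adjugate_fin_two] at h2
  have h3 := congrArg Complex.im h2
  simp [Matrix.star_apply] at h3
  rw [Matrix.trace_fin_two, Complex.add_im, h3]
  ring

/-- Both powers have determinant `(-1)^d`, so `Ĥ(k)^{-d} Ĥ(l)^d` lies in `SU(2)`, where traces are
real. -/
lemma meanOverlap_im (d : ℕ) (k l : ℝ) : (meanOverlap d k l).im = 0 := by
  have h := trace_im_of_mem_specialUnitary (star (Hhat k ^ d) * Hhat l ^ d)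
    (mul_mem (Unitary.star_mem (Hhat_pow_mem_unitaryGroup d k)) (Hhat_pow_mem_unitaryGroup d l))
    (by
      rw [Matrix.det_mul, Matrix.star_eq_conjTranspose, Matrix.det_conjTranspose, Matrix.det_pow,
        Matrix.det_pow, det_Hhat, det_Hhat]
      simp [← mul_pow])
  rw [meanOverlap_eq_trace, Complex.mul_im, h]
  simp

lemma contDiff_Hhat_pow (n : WithTop ℕ∞) (d : ℕ) (a b : Fin 2) :
    ContDiff ℝ n fun k : ℝ => (Hhat k ^ d) a b := by
  induction d generalizing a b with
  | zero => simpa using contDiff_const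
  | succ d ih =>
    simp only [pow_succ, Matrix.mul_apply]
    refine ContDiff.sum fun c _ => (ih a c).mul ?_
    simp only [Hhat_apply]
    have : ContDiff ℝ n fun k : ℝ => (k : ℂ) := Complex.ofRealCLM.contDiff
    exact ((contDiff_const.mul this).mul contDiff_const).cexp.mul contDiff_const

lemma contDiff_Hhat_pow_mulVec (n : WithTop ℕ∞) (d : ℕ) (φ : Fin 2 → ℂ) (a : Fin 2) :
    ContDiff ℝ n fun k : ℝ => (Hhat k ^ d).mulVec φ a := by
  simp only [Matrix.mulVec, dotProduct]
  exact ContDiff.sum fun c _ => (contDiff_Hhat_pow n d a c).mul contDiff_const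

lemma contDiff_overlap (n : WithTop ℕ∞) (d : ℕ) (φ : Fin 2 → ℂ) (k : ℝ) :
    ContDiff ℝ n fun l : ℝ => overlap d φ k l := by
  simp only [overlap]
  exact ContDiff.sum fun a _ => contDiff_const.mul (contDiff_Hhat_pow_mulVec n d φ a)

lemma contDiff_meanOverlap (n : WithTop ℕ∞) (d : ℕ) (k : ℝ) :
    ContDiff ℝ n fun l : ℝ => meanOverlap d k l := by
  simp only [meanOverlap]
  exact contDiff_const.mul (ContDiff.sum fun b _ => contDiff_overlap n d _ k)

lemma hasDerivAt_re {g : ℝ → ℂ} {g' : ℂ} {k : ℝ} (h : HasDerivAt g g' k) :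
    HasDerivAt (fun l => (g l).re) g'.re k :=
  Complex.reCLM.hasFDerivAt.comp_hasDerivAt k h

lemma hasDerivAt_im {g : ℝ → ℂ} {g' : ℂ} {k : ℝ} (h : HasDerivAt g g' k) :
    HasDerivAt (fun l => (g l).im) g'.im k :=
  Complex.imCLM.hasFDerivAt.comp_hasDerivAt k h

/-- If `‖g‖ ≤ 1` with `g k = 1`, then the derivative of `g` at `k` is purely imaginary. -/
lemma deriv_re_eq_zero_of_norm_le_one {g : ℝ → ℂ} {k : ℝ} (hg : DifferentiableAt ℝ g k)
    (hk : g k = 1) (hb : ∀ l, ‖g l‖ ≤ 1) : (deriv g k).re = 0 := by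
  have hmax : IsLocalMax (fun l => (g l).re) k := by
    refine Eventually.of_forall fun l => ?_
    simp only [hk, Complex.one_re]
    exact (Complex.re_le_norm _).trans (hb l)
  exact hmax.hasDerivAt_eq_zero (hasDerivAt_re hg.hasDerivAt)

lemma deriv_overlap_re (d : ℕ) (k : ℝ) : (deriv (fun l => overlap d phi0 k l) k).re = 0 :=
  deriv_re_eq_zero_of_norm_le_one
    ((contDiff_overlap 1 d phi0 k).differentiable (by norm_num) k)
    (by rw [overlap_self, sum_norm_sq_phi0, Complex.ofReal_one])
    (fun l => (norm_overlap_le d phi0 k l).trans_eq sum_norm_sq_phi0)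

/-- The real part is stationary at its maximum and the imaginary part is identically zero. The
absence of a first order term is why case (B) lives on the scale `√t`. -/
lemma deriv_meanOverlap (d : ℕ) (k : ℝ) : deriv (fun l => meanOverlap d k l) k = 0 := by
  have hd := (contDiff_meanOverlap 1 d k).differentiable (by norm_num) k
  refine Complex.ext (deriv_re_eq_zero_of_norm_le_one hd (meanOverlap_self d k)
    (norm_meanOverlap_le d k)) ?_
  have h := hasDerivAt_im hd.hasDerivAt
  simp only [meanOverlap_im] at h
  exact h.unique (hasDerivAt_const k 0)

/-- Identifies the drift with the first Taylor coefficient of the overlap in its second argument,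
the form in which it appears in the limit. -/
lemma mu_eq_deriv_overlap (d : ℕ) (k : ℝ) :
    mu d k = Complex.I * deriv (fun l => overlap d phi0 k l) k / d := by
  have h : deriv (fun l => overlap d phi0 k l) k
      = ∑ a, starRingEnd ℂ (psi d k a) * deriv (fun l => psi d l a) k := by
    simp only [overlap]
    rw [deriv_fun_sum]
    · refine Finset.sum_congr rfl fun a _ => ?_
      rw [deriv_const_mul]
      · rfl
      · exact (contDiff_Hhat_pow_mulVec 1 d phi0 a).differentiable (by norm_num) k
    · intro a _
      exact ((contDiff_Hhat_pow_mulVec 1 d phi0 a).differentiable (by norm_num) k).const_mul _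
  rw [mu, h, Finset.mul_sum]
  congr 1
  refine Finset.sum_congr rfl fun a _ => ?_
  rw [Dk]
  ring

lemma mu_im (d : ℕ) (k : ℝ) : (mu d k).im = 0 := by
  rw [mu_eq_deriv_overlap, Complex.div_natCast_im]
  simp [deriv_overlap_re]

lemma Dk_Dk (f : ℝ → ℂ) (k : ℝ) : Dk (Dk f) k = -deriv (deriv f) k := by
  have : Dk f = fun k => Complex.I * deriv f k := rfl
  rw [this, Dk, deriv_const_mul_field, ← mul_assoc, Complex.I_mul_I, neg_one_mul]

/-- The trace is linear, so derivatives pass to the entries. By unitarity the inverse is the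
adjoint, and `D_k²` is minus the second derivative. -/
lemma nu_eq_deriv_meanOverlap (d : ℕ) (k : ℝ) :
    nu d k = -deriv (deriv fun l => meanOverlap d k l) k / d := by
  have hent : ∀ a b, Differentiable ℝ fun l : ℝ => (Hhat l ^ d) a b := fun a b =>
    (contDiff_Hhat_pow 1 d a b).differentiable (by norm_num)
  have hent' : ∀ a b, Differentiable ℝ (deriv fun l : ℝ => (Hhat l ^ d) a b) := fun a b =>
    ((contDiff_succ_iff_deriv (n := 1)).1 (contDiff_Hhat_pow (1 + 1) d a b)).2.2.differentiable
      (by norm_num)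
  have hm : (fun l => meanOverlap d k l)
      = fun l => 1 / 2 * ∑ a, ∑ c, star (Hhat k ^ d) a c * (Hhat l ^ d) c a := by
    funext l
    rw [meanOverlap_eq_trace, Matrix.trace]
    simp only [Matrix.diag_apply, Matrix.mul_apply]
  have hd1 : deriv (fun l => meanOverlap d k l)
      = fun l => 1 / 2 * ∑ a, ∑ c, star (Hhat k ^ d) a c * deriv (fun l => (Hhat l ^ d) c a) l := by
    funext l
    rw [hm, deriv_const_mul_field, deriv_fun_sum]
    · congr 1
      refine Finset.sum_congr rfl fun a _ => ?_
      rw [deriv_fun_sum fun c _ => ((hent c a) l).const_mul _]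
      exact Finset.sum_congr rfl fun c _ => deriv_const_mul_field _
    · exact fun a _ => DifferentiableAt.fun_sum fun c _ => ((hent c a) l).const_mul _
  have hd2 : deriv (deriv fun l => meanOverlap d k l) k
      = 1 / 2 * ∑ a, ∑ c, star (Hhat k ^ d) a c *
          deriv (deriv fun l => (Hhat l ^ d) c a) k := by
    rw [hd1, deriv_const_mul_field, deriv_fun_sum]
    · congr 1
      refine Finset.sum_congr rfl fun a _ => ?_
      rw [deriv_fun_sum fun c _ => ((hent' c a) k).const_mul _]
      exact Finset.sum_congr rfl fun c _ => deriv_const_mul_field _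
    · exact fun a _ => DifferentiableAt.fun_sum fun c _ => ((hent' c a) k).const_mul _
  have hinv : (Hhat k ^ d)⁻¹ = star (Hhat k ^ d) :=
    Matrix.inv_eq_left_inv (Matrix.mem_unitaryGroup_iff'.1 (Hhat_pow_mem_unitaryGroup d k))
  rw [nu, hd2, hinv, Matrix.trace]
  simp only [Matrix.diag_apply, Matrix.mul_apply, Matrix.of_apply, Dk_Dk, mul_neg,
    Finset.sum_neg_distrib]
  ring

lemma continuous_mu (d : ℕ) : Continuous fun k => mu d k := by
  have h : ∀ a, Continuous fun k : ℝ => psi d k a := fun a =>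
    continuous_Hhat_pow_mulVec d phi0 a
  have h' : ∀ a, Continuous fun k : ℝ => Dk (fun l => psi d l a) k := fun a =>
    continuous_const.mul
      ((contDiff_Hhat_pow_mulVec 1 d phi0 a).continuous_deriv (by norm_num))
  refine Continuous.div_const (continuous_finsetSum _ fun a _ => ?_) _
  exact (Complex.continuous_conj.comp (h a)).mul (h' a)

lemma continuous_nu (d : ℕ) : Continuous fun k => nu d k := by
  have hinv : ∀ k, (Hhat k ^ d)⁻¹ = star (Hhat k ^ d) := fun k =>
    Matrix.inv_eq_left_inv (Matrix.mem_unitaryGroup_iff'.1 (Hhat_pow_mem_unitaryGroup d k))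
  have hent : ∀ a b, Continuous fun k : ℝ => Dk (Dk fun l => (Hhat l ^ d) a b) k := by
    intro a b
    simp only [Dk_Dk]
    have h1 : ContDiff ℝ 1 (deriv fun l => (Hhat l ^ d) a b) :=
      ((contDiff_succ_iff_deriv (n := 1)).1 (contDiff_Hhat_pow (1 + 1) d a b)).2.2
    exact (h1.continuous_deriv le_rfl).neg
  simp only [nu, hinv]
  refine Continuous.div_const (Continuous.matrix_trace (Continuous.matrix_mul ?_ ?_)) _
  · exact (continuous_Hhat_pow d).matrix_conjTranspose
  · exact continuous_matrix hent

/-! ### Second order behaviour -/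

lemma tendsto_mul_sub_of_deriv_eq_zero {g : ℝ → ℂ} {k : ℝ} (hg : ContDiff ℝ 2 g)
    (hk : g k = 1) (hk' : deriv g k = 0) {d : ℕ} (hd : 0 < d) (θ : ℝ) :
    Tendsto (fun M : ℕ => (M : ℂ) * (g (k + θ / Real.sqrt ((d * M : ℕ) : ℝ)) - 1)) atTop
      (𝓝 (θ ^ 2 / (2 * d) * deriv (deriv g) k)) := by
  have hT : ∀ x, taylorWithinEval g 2 Set.univ k x
      = 1 + ((x - k) ^ 2 / 2 : ℝ) * deriv (deriv g) k := by
    intro x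
    rw [taylorWithinEval_succ, taylorWithinEval_succ, taylor_within_zero_eval]
    simp only [iteratedDerivWithin_univ, iteratedDeriv_succ, iteratedDeriv_zero, hk, hk']
    simp
    left; norm_num; ring
  have ht := taylor_tendsto convex_univ (Set.mem_univ k) (n := 2) hg.contDiffOn
  simp only [hT, nhdsWithin_univ] at ht
  have hM : Tendsto (fun M : ℕ => Real.sqrt ((d * M : ℕ) : ℝ)) atTop atTop := by
    refine Real.tendsto_sqrt_atTop.comp (tendsto_natCast_atTop_atTop.comp ?_)
    exact tendsto_id.const_mul_atTop' hd
  have hh : Tendsto (fun M : ℕ => k + θ / Real.sqrt ((d * M : ℕ) : ℝ)) atTop (𝓝 k) := by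
    simpa using (hM.const_div_atTop θ).const_add k
  -- With the increment `h = θ / √(dM)` one has `M h² = θ² / d`, so this factor turns the Taylor
  -- remainder divided by `h²` into `M` times the remainder. Cancelling `h` requires `θ ≠ 0`; that
  -- case is separated below.
  have h2 := (ht.comp hh).const_mul ((θ ^ 2 / d : ℝ) : ℂ)
  rw [mul_zero] at h2
  have h3 := h2.add_const ((θ ^ 2 / (2 * d) : ℂ) * deriv (deriv g) k)
  rw [zero_add] at h3
  refine h3.congr' ?_
  filter_upwards [eventually_gt_atTop 0] with M hM0
  rcases eq_or_ne θ 0 with rfl | hθ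
  · simp [hk]
  have hdM : (0 : ℝ) < ((d * M : ℕ) : ℝ) := by exact_mod_cast Nat.mul_pos hd hM0
  have hsq : (θ / Real.sqrt ((d * M : ℕ) : ℝ)) ^ 2 = θ ^ 2 / (d * M) := by
    rw [div_pow, Real.sq_sqrt hdM.le]; push_cast; ring
  simp only [Function.comp, add_sub_cancel_left, hsq, Complex.real_smul]
  have : (θ : ℂ) ≠ 0 := by exact_mod_cast hθ
  have : (d : ℂ) ≠ 0 := by exact_mod_cast hd.ne'
  have : (M : ℂ) ≠ 0 := by exact_mod_cast hM0.ne'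
  push_cast
  field_simp
  ring

lemma tendsto_natCast_smul_sub {E : Type*} [NormedAddCommGroup E] [NormedSpace ℝ E]
    {g : ℝ → E} {g' : E} {k : ℝ} (hg : HasDerivAt g g' k) (c : ℝ) :
    Tendsto (fun n : ℕ => (n : ℝ) • (g (k + c / n) - g k)) atTop (𝓝 (c • g')) := by
  -- Differentiating in `t` at `0`, rather than in the increment `c / n`, also covers `c = 0`.
  have h1 : HasDerivAt (fun t : ℝ => g (k + c * t)) (c • g') 0 := by
    have h2 : HasDerivAt (fun t : ℝ => k + c * t) c 0 := by
      simpa using ((hasDerivAt_id (0 : ℝ)).const_mul c).const_add k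
    have h3 : HasDerivAt g g' (k + c * 0) := by simpa using hg
    exact h3.scomp 0 h2
  have h4 : Tendsto (fun n : ℕ => (n : ℝ)⁻¹) atTop (𝓝[≠] 0) :=
    tendsto_nhdsWithin_iff.2 ⟨tendsto_inv_atTop_nhds_zero_nat, by
      filter_upwards [eventually_gt_atTop 0] with n hn
      simpa using hn.ne'⟩
  refine ((hasDerivAt_iff_tendsto_slope.1 h1).comp h4).congr fun n => ?_
  simp [slope_def_module, div_eq_mul_inv]

lemma tendsto_mul_sub_of_hasDerivAt {g : ℝ → ℂ} {g' : ℂ} {k : ℝ} (hg : HasDerivAt g g' k)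
    (hk : g k = 1) (d : ℕ) (θ : ℝ) :
    Tendsto (fun M : ℕ => (M : ℂ) * (g (k + θ / ((d * M : ℕ) : ℝ)) - 1)) atTop
      (𝓝 (θ / d * g')) := by
  have h := tendsto_natCast_smul_sub hg (θ / d)
  simp only [Complex.real_smul, hk, div_div] at h
  exact_mod_cast h

/-- By the Taylor limit with `θ = 1`, `-ν/2` is a limit of `M` times (half trace minus one). These
numbers are real and nonpositive, so no explicit formula for `ν` is needed. -/
lemma nu_im_re (d : ℕ) (hd : 0 < d) (k : ℝ) : (nu d k).im = 0 ∧ 0 ≤ (nu d k).re := by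
  have h := tendsto_mul_sub_of_deriv_eq_zero (contDiff_meanOverlap 2 d k) (meanOverlap_self d k)
    (deriv_meanOverlap d k) hd 1
  have hd' : (0 : ℝ) < d := by exact_mod_cast hd
  have hnu : ((1 : ℝ) : ℂ) ^ 2 / (2 * d) * deriv (deriv fun l => meanOverlap d k l) k
      = -nu d k / 2 := by
    have : (d : ℂ) ≠ 0 := by exact_mod_cast hd.ne'
    rw [nu_eq_deriv_meanOverlap]
    field_simp
    simp
  rw [hnu] at h
  have him := (Complex.continuous_im.tendsto _).comp h
  have hre := (Complex.continuous_re.tendsto _).comp h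
  constructor
  · have h0 : Tendsto (fun _ : ℕ => (0 : ℝ)) atTop (𝓝 (-nu d k / 2).im) := by
      refine him.congr fun M => ?_
      simp [meanOverlap_im]
    have := tendsto_nhds_unique h0 tendsto_const_nhds
    simp at this
    exact this
  · have hle : (-nu d k / 2).re ≤ 0 := by
      refine le_of_tendsto hre (Eventually.of_forall fun M => ?_)
      have h1 := (Complex.re_le_norm _).trans
        (norm_meanOverlap_le d k (k + 1 / Real.sqrt ((d * M : ℕ) : ℝ)))
      simp only [Function.comp]
      rw [← Complex.ofReal_natCast M, Complex.re_ofReal_mul, Complex.sub_re, Complex.one_re]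
      exact mul_nonpos_of_nonneg_of_nonpos (Nat.cast_nonneg _) (by linarith)
    simp at hle
    linarith

/-! ### The limit `M → ∞` -/

/-- The symmetry `J Ĥ(k) J⁻¹ = -Ĥ(-k)`, where `J φ₀ = i φ₀`. -/
lemma Hhat_neg_mul (k : ℝ) :
    Hhat (-k) * !![0, 1; -1, 0] = -(!![0, 1; -1, 0] * Hhat k) := by
  ext a b
  fin_cases a <;> fin_cases b <;>
    simp [Matrix.mul_apply, Matrix.vecMul, dotProduct, Fin.sum_univ_two, Hhat_apply, shift, hadamard]

lemma Hhat_neg_pow_mul (d : ℕ) (k : ℝ) :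
    Hhat (-k) ^ d * !![0, 1; -1, 0] = (-1 : ℂ) ^ d • (!![0, 1; -1, 0] * Hhat k ^ d) := by
  induction d with
  | zero => simp
  | succ d ih =>
    rw [pow_succ', mul_assoc, ih, Matrix.mul_smul, ← mul_assoc, Hhat_neg_mul, neg_mul, mul_assoc,
      ← pow_succ', smul_neg, pow_succ (-1 : ℂ), mul_neg_one, neg_smul]

lemma phi0_eigenvector :
    (!![0, 1; -1, 0] : Matrix (Fin 2) (Fin 2) ℂ).mulVec phi0 = Complex.I • phi0 := by
  ext a
  fin_cases a <;> simp [phi0, Matrix.mulVec, dotProduct, Fin.sum_univ_two, ← mul_assoc]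

lemma psi_neg (d : ℕ) (k : ℝ) :
    psi d (-k) = (-1 : ℂ) ^ d • (-Complex.I) •
      (!![0, 1; -1, 0] : Matrix (Fin 2) (Fin 2) ℂ).mulVec (psi d k) := by
  have h : phi0 = (-Complex.I) • (!![0, 1; -1, 0] : Matrix (Fin 2) (Fin 2) ℂ).mulVec phi0 := by
    rw [phi0_eigenvector, smul_smul]; simp
  conv_lhs => rw [psi, h]
  rw [Matrix.mulVec_smul, Matrix.mulVec_mulVec, Hhat_neg_pow_mul, Matrix.smul_mulVec,
    ← Matrix.mulVec_mulVec, smul_comm]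
  rfl

/-- The sign `(-1)^d`, the phase `-i` and the unitary `J` relating the states at `k` and `-k` all
cancel in the inner product. -/
lemma overlap_neg (d : ℕ) (k l : ℝ) :
    overlap d phi0 (-k) (-l) = overlap d phi0 k l := by
  have h : ∀ k l, overlap d phi0 k l = ∑ a, starRingEnd ℂ (psi d k a) * psi d l a :=
    fun _ _ => rfl
  have h1 : ((-1 : ℂ) ^ d) * ((-1 : ℂ) ^ d) = 1 := by rw [← mul_pow]; simp
  rw [h, h, psi_neg, psi_neg]
  simp only [Fin.sum_univ_two, Matrix.mulVec, dotProduct, Pi.smul_apply, smul_eq_mul]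
  simp
  linear_combination (-(Complex.I ^ 2) * ((starRingEnd ℂ) (psi d k 1) * psi d l 1 +
    (starRingEnd ℂ) (psi d k 0) * psi d l 0)) * h1 - ((starRingEnd ℂ) (psi d k 1) * psi d l 1 +
    (starRingEnd ℂ) (psi d k 0) * psi d l 0) * Complex.I_sq

lemma Hhat_periodic (k : ℝ) : Hhat (k + 2 * Real.pi) = Hhat k := by
  ext a b
  rw [Hhat_apply, Hhat_apply]
  congr 1
  rw [Complex.exp_eq_exp_iff_exists_int]
  exact ⟨shift a, by push_cast; ring⟩

lemma overlap_add_two_pi (d : ℕ) (φ : Fin 2 → ℂ) (k l : ℝ) :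
    overlap d φ (k + 2 * Real.pi) (l + 2 * Real.pi) = overlap d φ k l := by
  simp only [overlap, Hhat_periodic]

/-- In case (A) the law of the position is symmetric. -/
lemma integral_overlap_pow_neg (d M : ℕ) (θ : ℝ) :
    ∫ k in (0 : ℝ)..(2 * Real.pi), overlap d phi0 k (k + θ) ^ M
      = ∫ k in (0 : ℝ)..(2 * Real.pi), overlap d phi0 k (k - θ) ^ M := by
  have h := intervalIntegral.integral_comp_sub_left
    (fun k => overlap d phi0 k (k + θ) ^ M) (a := 0) (b := 2 * Real.pi) (2 * Real.pi)
  rw [sub_self, sub_zero] at h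
  rw [← h]
  refine intervalIntegral.integral_congr fun k _ => ?_
  have e : overlap d phi0 (2 * Real.pi - k) (2 * Real.pi - k + θ)
      = overlap d phi0 (-k + 2 * Real.pi) (-(k - θ) + 2 * Real.pi) := by
    congr 1 <;> ring
  rw [e, overlap_add_two_pi, overlap_neg]

/-- The uniform distribution on `[0, 2π)`. -/
noncomputable def uniformAngle : Measure ℝ :=
  ENNReal.ofReal (2 * Real.pi)⁻¹ • volume.restrict (Set.Ico 0 (2 * Real.pi))

instance : IsProbabilityMeasure uniformAngle := by
  refine ⟨?_⟩
  rw [uniformAngle, Measure.smul_apply, Measure.restrict_apply_univ, Real.volume_Ico, smul_eq_mul,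
    ← ENNReal.ofReal_mul (by positivity), sub_zero, inv_mul_cancel₀ (by positivity),
    ENNReal.ofReal_one]

lemma integral_uniformAngle {E : Type*} [NormedAddCommGroup E] [NormedSpace ℝ E] (f : ℝ → E) :
    ∫ k, f k ∂uniformAngle = (2 * Real.pi)⁻¹ • ∫ k in (0 : ℝ)..(2 * Real.pi), f k := by
  rw [uniformAngle, integral_smul_measure, ENNReal.toReal_ofReal (by positivity),
    intervalIntegral.integral_of_le (by positivity), integral_Ico_eq_integral_Ioo,
    integral_Ioc_eq_integral_Ioo]

lemma integral_uniformAngle_complex (f : ℝ → ℂ) :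
    ∫ k, f k ∂uniformAngle
      = ((2 * Real.pi)⁻¹ : ℝ) * ∫ k in (0 : ℝ)..(2 * Real.pi), f k := by
  rw [integral_uniformAngle, Complex.real_smul]

lemma charFun_positionA_eq (M d : ℕ) (s θ : ℝ) :
    charFun (scaledLaw (positionA M (d * M)) s : Measure ℝ) θ
      = ∫ k, overlap d phi0 k (k + θ / s) ^ M ∂uniformAngle := by
  rw [charFun_positionA, integral_uniformAngle_complex]

lemma charFun_positionB_eq (M d : ℕ) (s θ : ℝ) :
    charFun (scaledLaw (positionB M (d * M)) s : Measure ℝ) θ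
      = ∫ k, meanOverlap d k (k + θ / s) ^ M ∂uniformAngle := by
  rw [charFun_positionB, integral_uniformAngle_complex]

lemma norm_pow_overlap_le_one (d M : ℕ) (k l : ℝ) : ‖overlap d phi0 k l ^ M‖ ≤ 1 := by
  rw [norm_pow]
  exact pow_le_one₀ (norm_nonneg _) ((norm_overlap_le d phi0 k l).trans_eq sum_norm_sq_phi0)

lemma norm_pow_meanOverlap_le_one (d M : ℕ) (k l : ℝ) : ‖meanOverlap d k l ^ M‖ ≤ 1 := by
  rw [norm_pow]
  exact pow_le_one₀ (norm_nonneg _) (norm_meanOverlap_le d k l)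

lemma continuous_overlap_add (d : ℕ) (φ : Fin 2 → ℂ) (θ : ℝ) :
    Continuous fun k => overlap d φ k (k + θ) :=
  (continuous_overlap d φ).comp (f := fun k : ℝ => (k, k + θ)) (by fun_prop)

lemma continuous_meanOverlap_add (d : ℕ) (θ : ℝ) :
    Continuous fun k => meanOverlap d k (k + θ) :=
  (continuous_meanOverlap d).comp (f := fun k : ℝ => (k, k + θ)) (by fun_prop)

/-- The limit law for `d` fixed, case (A). -/
noncomputable def driftLaw (d : ℕ) : ProbabilityMeasure ℝ :=
  ⟨uniformAngle.map fun k => (mu d k).re, Measure.isProbabilityMeasure_map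
    (Complex.continuous_re.comp (continuous_mu d)).aemeasurable⟩

lemma setIntegral_const_uniformAngle {S : Set ℝ} (hS : MeasurableSet S) :
    uniformAngle.real S
      = ∫ _k in {k : ℝ | k ∈ Set.Ico 0 (2 * Real.pi) ∧ k ∈ S}, 1 / (2 * Real.pi) := by
  rw [setIntegral_const, uniformAngle, measureReal_def, Measure.smul_apply,
    Measure.restrict_apply hS, smul_eq_mul, ENNReal.toReal_mul,
    ENNReal.toReal_ofReal (by positivity), measureReal_def, smul_eq_mul, mul_comm, one_div,
    Set.inter_comm]
  rfl

lemma cdf_driftLaw (d : ℕ) (x : ℝ) :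
    cdf (driftLaw d : Measure ℝ) x =
      ∫ _k in {k : ℝ | k ∈ Set.Ico 0 (2 * Real.pi) ∧ (mu d k).re ≤ x}, 1 / (2 * Real.pi) := by
  have hm : Measurable fun k => (mu d k).re :=
    (Complex.continuous_re.comp (continuous_mu d)).measurable
  rw [cdf_eq_real, driftLaw, ProbabilityMeasure.coe_mk, map_measureReal_apply hm measurableSet_Iic,
    setIntegral_const_uniformAngle (hm measurableSet_Iic)]
  rfl

lemma tendsto_driftLaw (d : ℕ) :
    Tendsto (fun M : ℕ => scaledLaw (positionA M (d * M)) ((d * M : ℕ) : ℝ)) atTop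
      (𝓝 (driftLaw d)) := by
  refine ProbabilityMeasure.tendsto_of_tendsto_charFun fun θ => ?_
  have hm : Measurable fun k => (mu d k).re :=
    (Complex.continuous_re.comp (continuous_mu d)).measurable
  have hY : charFun (driftLaw d : Measure ℝ) θ
      = ∫ k, Complex.exp (θ * (mu d k).re * Complex.I) ∂uniformAngle := by
    rw [charFun_apply_real, driftLaw, ProbabilityMeasure.coe_mk,
      integral_map hm.aemeasurable (by fun_prop)]
  -- Expanding at `+θ` would produce `exp(-iθμ)`, because `μ = i g' / d` for the derivative `g'` of
  -- the overlap. The symmetry of the law allows `-θ` instead.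
  have hA : ∀ M : ℕ, charFun (scaledLaw (positionA M (d * M)) ((d * M : ℕ) : ℝ) : Measure ℝ) θ
      = ∫ k, overlap d phi0 k (k + (-θ) / ((d * M : ℕ) : ℝ)) ^ M ∂uniformAngle := by
    intro M
    rw [charFun_positionA_eq, integral_uniformAngle_complex, integral_uniformAngle_complex,
      integral_overlap_pow_neg]
    simp only [neg_div, sub_eq_add_neg]
  rw [hY]
  simp only [hA]
  refine tendsto_integral_of_dominated_convergence (fun _ => 1)
    (fun M => ((continuous_overlap_add d phi0 _).pow M).aestronglyMeasurable)
    (integrable_const 1) (fun M => ae_of_all _ fun k => norm_pow_overlap_le_one d M _ _)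
    (ae_of_all _ fun k => ?_)
  have h := tendsto_mul_sub_of_hasDerivAt
    ((contDiff_overlap 1 d phi0 k).differentiable (by norm_num) k).hasDerivAt
    (by rw [overlap_self, sum_norm_sq_phi0, Complex.ofReal_one]) d (-θ)
  have h2 := Complex.tendsto_one_add_pow_exp_of_tendsto h
  simp only [add_sub_cancel] at h2
  convert h2 using 3
  have hre : ((mu d k).re : ℂ) = mu d k := Complex.ext rfl (by simp [mu_im])
  rw [hre, mu_eq_deriv_overlap]
  push_cast
  linear_combination (θ * deriv (fun l => overlap d phi0 k l) k / d) * Complex.I_sq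

/-- The limit law for `d` fixed, case (B). -/
noncomputable def mixtureLaw (d : ℕ) : ProbabilityMeasure ℝ :=
  ⟨(uniformAngle.prod (gaussianReal 0 1)).map fun p => p.2 * Real.sqrt (nu d p.1).re,
    Measure.isProbabilityMeasure_map (by
      have := Complex.continuous_re.comp (continuous_nu d)
      exact (continuous_snd.mul
        (Real.continuous_sqrt.comp (this.comp continuous_fst))).aemeasurable)⟩

lemma continuous_mul_sqrt_nu (d : ℕ) :
    Continuous fun p : ℝ × ℝ => p.2 * Real.sqrt (nu d p.1).re :=
  continuous_snd.mul (Real.continuous_sqrt.comp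
    ((Complex.continuous_re.comp (continuous_nu d)).comp continuous_fst))

lemma uniformAngle_prod_gaussianReal :
    uniformAngle.prod (gaussianReal 0 1)
      = (volume.restrict (Set.Ico 0 (2 * Real.pi) ×ˢ Set.univ)).withDensity
        fun p : ℝ × ℝ => ENNReal.ofReal (Real.exp (-p.2 ^ 2 / 2) / (2 * Real.pi) ^ (3 / 2 : ℝ)) := by
  have h1 : uniformAngle = (volume.restrict (Set.Ico 0 (2 * Real.pi))).withDensity
      fun _ => ENNReal.ofReal (2 * Real.pi)⁻¹ := by
    rw [withDensity_const, uniformAngle]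
  have hpow : (2 * Real.pi) ^ (3 / 2 : ℝ) = (2 * Real.pi) * Real.sqrt (2 * Real.pi) := by
    rw [Real.sqrt_eq_rpow, ← Real.rpow_one_add' (by positivity) (by norm_num)]
    norm_num
  rw [h1, gaussianReal_of_var_ne_zero _ one_ne_zero,
    prod_withDensity measurable_const (measurable_gaussianPDF 0 1), Measure.volume_eq_prod,
    ← Measure.prod_restrict, Measure.restrict_univ]
  congr 1
  funext p
  rw [gaussianPDF, ← ENNReal.ofReal_mul (by positivity), gaussianPDFReal, hpow]
  congr 1
  simp only [NNReal.coe_one, mul_one, sub_zero]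
  field_simp

lemma cdf_mixtureLaw (d : ℕ) (x : ℝ) :
    cdf (mixtureLaw d : Measure ℝ) x =
      ∫ p in {p : ℝ × ℝ | p.1 ∈ Set.Ico 0 (2 * Real.pi) ∧
          p.2 * Real.sqrt (nu d p.1).re ≤ x},
        Real.exp (-p.2 ^ 2 / 2) / (2 * Real.pi) ^ (3 / 2 : ℝ) := by
  have hm := (continuous_mul_sqrt_nu d).measurable
  have hS : MeasurableSet {p : ℝ × ℝ | p.2 * Real.sqrt (nu d p.1).re ≤ x} := hm measurableSet_Iic
  have hset : {p : ℝ × ℝ | p.1 ∈ Set.Ico 0 (2 * Real.pi) ∧ p.2 * Real.sqrt (nu d p.1).re ≤ x}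
      = {p : ℝ × ℝ | p.2 * Real.sqrt (nu d p.1).re ≤ x} ∩
        (Set.Ico 0 (2 * Real.pi) ×ˢ Set.univ) := by
    ext p
    simp [and_comm]
  rw [cdf_eq_real, mixtureLaw, ProbabilityMeasure.coe_mk, map_measureReal_apply hm measurableSet_Iic,
    uniformAngle_prod_gaussianReal, measureReal_def,
    withDensity_apply _ (hm measurableSet_Iic), hset, ← Measure.restrict_restrict hS,
    integral_eq_lintegral_of_nonneg_ae (ae_of_all _ fun p => by positivity)
      (Continuous.aestronglyMeasurable (by fun_prop))]
  rfl

lemma tendsto_mixtureLaw (d : ℕ) (hd : 0 < d) :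
    Tendsto (fun M : ℕ => scaledLaw (positionB M (d * M)) (Real.sqrt ((d * M : ℕ) : ℝ))) atTop
      (𝓝 (mixtureLaw d)) := by
  refine ProbabilityMeasure.tendsto_of_tendsto_charFun fun θ => ?_
  have hm := (continuous_mul_sqrt_nu d).measurable
  -- For fixed `k` the inner integral is the standard Gaussian characteristic function at `θ√ν`.
  -- Nonnegativity of `ν` gives `(√ν)² = ν`.
  have hZ : charFun (mixtureLaw d : Measure ℝ) θ
      = ∫ k, Complex.exp (-(θ ^ 2 * (nu d k).re / 2)) ∂uniformAngle := by
    rw [charFun_apply_real, mixtureLaw, ProbabilityMeasure.coe_mk,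
      integral_map hm.aemeasurable (by fun_prop), integral_prod]
    · congr 1
      funext k
      have h := charFun_gaussianReal (μ := 0) (v := 1) (θ * Real.sqrt (nu d k).re)
      rw [charFun_apply_real] at h
      have hsq : ((Real.sqrt (nu d k).re : ℝ) : ℂ) ^ 2 = (nu d k).re := by
        rw [← Complex.ofReal_pow, Real.sq_sqrt (nu_im_re d hd k).2]
      convert h using 1
      · congr 1
        funext u
        congr 1
        push_cast
        ring
      · congr 1
        push_cast
        rw [mul_pow, hsq]
        simp
    · refine Integrable.of_bound (Continuous.aestronglyMeasurable ?_) 1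
        (ae_of_all _ fun p => le_of_eq ?_)
      · have := continuous_mul_sqrt_nu d
        fun_prop
      · rw [← Complex.ofReal_mul, Complex.norm_exp_ofReal_mul_I]
  rw [hZ]
  simp only [charFun_positionB_eq]
  refine tendsto_integral_of_dominated_convergence (fun _ => 1)
    (fun M => ((continuous_meanOverlap_add d _).pow M).aestronglyMeasurable)
    (integrable_const 1) (fun M => ae_of_all _ fun k => norm_pow_meanOverlap_le_one d M _ _)
    (ae_of_all _ fun k => ?_)
  have h := tendsto_mul_sub_of_deriv_eq_zero (contDiff_meanOverlap 2 d k) (meanOverlap_self d k)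
    (deriv_meanOverlap d k) hd θ
  have h2 := Complex.tendsto_one_add_pow_exp_of_tendsto h
  simp only [add_sub_cancel] at h2
  convert h2 using 3
  have hre : ((nu d k).re : ℂ) = nu d k := Complex.ext rfl (by simp [(nu_im_re d hd k).1])
  rw [hre, nu_eq_deriv_meanOverlap]
  ring

/-! ### Spectral decomposition and the limit `d → ∞` -/

/-- The argument of the first eigenvalue of `Ĥ(k)`. -/
noncomputable def angle (k : ℝ) : ℝ := Real.arcsin (Real.sin k / Real.sqrt 2)

/-- The derivative of `angle`. -/
noncomputable def speed (k : ℝ) : ℝ := Real.cos k / Real.sqrt (1 + Real.cos k ^ 2)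

lemma one_add_cos_sq_pos (k : ℝ) : 0 < 1 + Real.cos k ^ 2 := by positivity

lemma abs_sin_div_sqrt_two_lt (k : ℝ) :
    -1 < Real.sin k / Real.sqrt 2 ∧ Real.sin k / Real.sqrt 2 < 1 := by
  rw [← abs_lt, ← sq_lt_one_iff_abs_lt_one, div_pow, Real.sq_sqrt (by norm_num)]
  have := Real.sin_sq_le_one k
  linarith

lemma sin_angle (k : ℝ) : Real.sin (angle k) = Real.sin k / Real.sqrt 2 :=
  Real.sin_arcsin (abs_sin_div_sqrt_two_lt k).1.le (abs_sin_div_sqrt_two_lt k).2.le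

lemma cos_angle (k : ℝ) :
    Real.cos (angle k) = Real.sqrt (1 + Real.cos k ^ 2) / Real.sqrt 2 := by
  rw [angle, Real.cos_arcsin, ← Real.sqrt_div (one_add_cos_sq_pos k).le]
  congr 1
  rw [div_pow, Real.sq_sqrt (by norm_num), Real.sin_sq]
  ring

lemma cos_angle_pos (k : ℝ) : 0 < Real.cos (angle k) := by
  rw [cos_angle]
  have := one_add_cos_sq_pos k
  positivity

lemma hasDerivAt_angle (k : ℝ) : HasDerivAt angle (speed k) k := by
  have h1 : HasDerivAt (fun k => Real.sin k / Real.sqrt 2) (Real.cos k / Real.sqrt 2) k :=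
    (Real.hasDerivAt_sin k).div_const _
  have h2 := (Real.hasDerivAt_arcsin (abs_sin_div_sqrt_two_lt k).1.ne'
    (abs_sin_div_sqrt_two_lt k).2.ne).comp k h1
  refine h2.congr_deriv ?_
  rw [← Real.cos_arcsin]
  change 1 / Real.cos (angle k) * _ = _
  have := one_add_cos_sq_pos k
  rw [cos_angle, speed]
  field_simp

lemma continuous_angle : Continuous angle :=
  continuous_iff_continuousAt.2 fun k => (hasDerivAt_angle k).continuousAt

/-- The two eigenvalues of `Ĥ(k)`. -/
noncomputable def eigenvalue (k : ℝ) : Fin 2 → ℂ :=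
  ![Complex.exp (angle k * Complex.I), -Complex.exp (-angle k * Complex.I)]

lemma eigenvalue_zero_sub_one (k : ℝ) :
    eigenvalue k 0 - eigenvalue k 1 = 2 * Real.cos (angle k) := by
  simp only [eigenvalue, Matrix.cons_val_zero, Matrix.cons_val_one, Complex.ofReal_cos]
  rw [Complex.two_cos]
  ring

/-- Since `|sin k / √2| < 1`, the cosine of the angle is positive and the spectral gap never closes.
This makes the spectral projections continuous in `k`. -/
lemma eigenvalue_zero_sub_one_ne_zero (k : ℝ) : eigenvalue k 0 - eigenvalue k 1 ≠ 0 := by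
  rw [eigenvalue_zero_sub_one]
  have := (cos_angle_pos k).ne'
  exact mul_ne_zero two_ne_zero (by exact_mod_cast this)

/-- The trace of `Ĥ(k)` is `i√2 sin k`, and `e^{iα} - e^{-iα} = 2i sin α`. This dictates the arcsine
in the definition of the angle. -/
lemma eigenvalue_add (k : ℝ) : eigenvalue k 0 + eigenvalue k 1 = (Hhat k).trace := by
  have h : (Real.sin (angle k) : ℂ) = Real.sin k / Real.sqrt 2 := by
    rw [sin_angle]; push_cast; rfl
  have e1 : eigenvalue k 0 + eigenvalue k 1 = 2 * Real.sin (angle k) * Complex.I := by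
    simp only [eigenvalue, Matrix.cons_val_zero, Matrix.cons_val_one, Complex.ofReal_sin]
    rw [Complex.two_sin]
    linear_combination (Complex.exp (angle k * Complex.I) - Complex.exp (-angle k * Complex.I))
      * Complex.I_sq
  have e2 : (Real.sin k : ℂ) = (Complex.exp (-k * Complex.I) - Complex.exp (k * Complex.I))
      * Complex.I / 2 := by rw [Complex.ofReal_sin, Complex.sin]
  rw [e1, h, Matrix.trace_fin_two, Hhat_apply, Hhat_apply, e2]
  simp only [shift, hadamard, Matrix.smul_apply, Matrix.of_apply, Matrix.cons_val',
    Matrix.cons_val_zero, Matrix.cons_val_one, smul_eq_mul, Matrix.cons_val_fin_one]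
  have a1 : Complex.I * k * ((1 : ℤ) : ℂ) = k * Complex.I := by push_cast; ring
  have a2 : Complex.I * k * ((-1 : ℤ) : ℂ) = -k * Complex.I := by push_cast; ring
  rw [a1, a2]
  push_cast
  linear_combination ((Complex.exp (-k * Complex.I) - Complex.exp (k * Complex.I)) /
    Real.sqrt 2) * Complex.I_sq

lemma eigenvalue_mul (k : ℝ) : eigenvalue k 0 * eigenvalue k 1 = (Hhat k).det := by
  rw [det_Hhat]
  simp only [eigenvalue, Matrix.cons_val_zero, Matrix.cons_val_one]
  rw [mul_neg, ← Complex.exp_add]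
  simp

lemma norm_eigenvalue (k : ℝ) (i : Fin 2) : ‖eigenvalue k i‖ = 1 := by
  fin_cases i
  · simp [eigenvalue, Complex.norm_exp_ofReal_mul_I]
  · have := Complex.norm_exp_ofReal_mul_I (-angle k)
    simp [eigenvalue] at this ⊢
    exact this

lemma matrix_fin_two_sq (A : Matrix (Fin 2) (Fin 2) ℂ) :
    A * A = A.trace • A - A.det • (1 : Matrix (Fin 2) (Fin 2) ℂ) := by
  ext a b
  fin_cases a <;> fin_cases b <;>
    simp [Matrix.mul_apply, Fin.sum_univ_two, Matrix.trace_fin_two, Matrix.det_fin_two] <;> ring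

/-- The two spectral projections of `Ĥ(k)`. -/
noncomputable def spectralProj (k : ℝ) : Fin 2 → Matrix (Fin 2) (Fin 2) ℂ :=
  ![(eigenvalue k 0 - eigenvalue k 1)⁻¹ • (Hhat k - eigenvalue k 1 • 1),
    (eigenvalue k 0 - eigenvalue k 1)⁻¹ • (eigenvalue k 0 • 1 - Hhat k)]

lemma spectralProj_add (k : ℝ) : spectralProj k 0 + spectralProj k 1 = 1 := by
  simp only [spectralProj, Matrix.cons_val_zero, Matrix.cons_val_one]
  rw [← smul_add, add_comm, sub_add_sub_cancel, ← sub_smul, smul_smul,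
    inv_mul_cancel₀ (eigenvalue_zero_sub_one_ne_zero k), one_smul]

/-- By Cayley–Hamilton `(Ĥ - λ₀)(Ĥ - λ₁) = 0`. The projections are Lagrange interpolants in `Ĥ`, so
no eigenvectors have to be chosen. -/
lemma Hhat_mul_spectralProj (k : ℝ) (i : Fin 2) :
    Hhat k * spectralProj k i = eigenvalue k i • spectralProj k i := by
  have h := matrix_fin_two_sq (Hhat k)
  rw [← eigenvalue_add, ← eigenvalue_mul] at h
  fin_cases i <;>
    simp only [spectralProj, Fin.zero_eta, Fin.mk_one, Matrix.cons_val_zero, Matrix.cons_val_one,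
      Matrix.mul_smul, mul_sub, mul_one, h] <;>
    module

lemma Hhat_pow_mul_spectralProj (d : ℕ) (k : ℝ) (i : Fin 2) :
    Hhat k ^ d * spectralProj k i = eigenvalue k i ^ d • spectralProj k i := by
  induction d with
  | zero => simp
  | succ d ih =>
    rw [pow_succ, mul_assoc, Hhat_mul_spectralProj, Matrix.mul_smul, ih, smul_smul, pow_succ']

lemma eigenvalue_ne_zero (k : ℝ) (i : Fin 2) : eigenvalue k i ≠ 0 := by
  rw [← norm_pos_iff, norm_eigenvalue]; norm_num

lemma star_Hhat_pow_mul_spectralProj (d : ℕ) (k : ℝ) (i : Fin 2) :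
    star (Hhat k ^ d) * spectralProj k i = (eigenvalue k i ^ d)⁻¹ • spectralProj k i := by
  have h := congrArg (star (Hhat k ^ d) * ·) (Hhat_pow_mul_spectralProj d k i)
  simp only [← mul_assoc, Matrix.mul_smul,
    Matrix.mem_unitaryGroup_iff'.1 (Hhat_pow_mem_unitaryGroup d k), one_mul] at h
  rw [h, smul_smul, inv_mul_cancel₀ (pow_ne_zero d (eigenvalue_ne_zero k i)), one_smul, ← h]

lemma continuous_eigenvalue (i : Fin 2) : Continuous fun k => eigenvalue k i := by
  have := continuous_angle
  fin_cases i
  · simp only [eigenvalue, Fin.zero_eta, Matrix.cons_val_zero]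
    fun_prop
  · simp only [eigenvalue, Fin.mk_one, Matrix.cons_val_one, Matrix.cons_val_fin_one]
    fun_prop

lemma continuous_spectralProj (i : Fin 2) : Continuous fun k => spectralProj k i := by
  have hH : Continuous Hhat := by simpa using continuous_Hhat_pow 1
  have h0 := continuous_eigenvalue 0
  have h1 := continuous_eigenvalue 1
  have hinv : Continuous fun k => (eigenvalue k 0 - eigenvalue k 1)⁻¹ :=
    (h0.sub h1).inv₀ eigenvalue_zero_sub_one_ne_zero
  fin_cases i
  · exact hinv.smul (hH.sub (h1.smul continuous_const))
  · exact hinv.smul ((h0.smul continuous_const).sub hH)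

/-- The first term freezes the projection at `k` and keeps only a ratio of phases. The second is an
error governed by the variation of the projection from `k` to `l`. -/
lemma star_Hhat_pow_mul_Hhat_pow (d : ℕ) (k l : ℝ) :
    star (Hhat k ^ d) * Hhat l ^ d
      = ∑ i, ((eigenvalue l i / eigenvalue k i) ^ d • spectralProj k i +
          eigenvalue l i ^ d • (star (Hhat k ^ d) * (spectralProj l i - spectralProj k i))) := by
  have h : Hhat l ^ d = ∑ i, eigenvalue l i ^ d • spectralProj l i := by
    rw [← mul_one (Hhat l ^ d), ← spectralProj_add l, mul_add, Hhat_pow_mul_spectralProj,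
      Hhat_pow_mul_spectralProj, Fin.sum_univ_two]
  rw [h, Finset.mul_sum]
  refine Finset.sum_congr rfl fun i _ => ?_
  rw [Matrix.mul_smul, mul_sub, star_Hhat_pow_mul_spectralProj, smul_sub, smul_smul, div_pow,
    div_eq_mul_inv]
  abel

/-- The minus sign of the second eigenvalue cancels in the quotient, so the parity of `d` leaves no
trace. -/
lemma eigenvalue_div_pow (d : ℕ) (k l : ℝ) (i : Fin 2) :
    (eigenvalue l i / eigenvalue k i) ^ d
      = Complex.exp ((-1) ^ (i : ℕ) * ((d : ℝ) • (angle l - angle k) : ℝ) * Complex.I) := by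
  fin_cases i
  · simp only [eigenvalue, Fin.zero_eta, Matrix.cons_val_zero]
    rw [← Complex.exp_sub, ← Complex.exp_nat_mul]
    congr 1
    simp
    ring
  · simp only [eigenvalue, Fin.mk_one, Matrix.cons_val_one, Matrix.cons_val_fin_one]
    rw [neg_div_neg_eq, ← Complex.exp_sub, ← Complex.exp_nat_mul]
    congr 1
    simp
    ring

/-- The phases converge because `d (α(k + c/d) - α(k)) → c α'(k)`. The error vanishes because the
projections are continuous and are multiplied by unitary entries and phases of modulus at most one.
-/
lemma tendsto_star_Hhat_pow_mul_Hhat_pow (k c : ℝ) :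
    Tendsto (fun d : ℕ => star (Hhat k ^ d) * Hhat (k + c / d) ^ d) atTop
      (𝓝 (∑ i : Fin 2, Complex.exp ((-1) ^ (i : ℕ) * (c * speed k : ℝ) * Complex.I) •
        spectralProj k i)) := by
  have hl : Tendsto (fun d : ℕ => k + c / d) atTop (𝓝 k) := by
    simpa using (tendsto_natCast_atTop_atTop.const_div_atTop c).const_add k
  simp only [star_Hhat_pow_mul_Hhat_pow]
  refine tendsto_finsetSum _ fun i _ => ?_
  rw [← add_zero (Complex.exp _ • spectralProj k i)]
  refine Tendsto.add ?_ ?_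
  · refine Tendsto.smul_const ?_ _
    simp only [eigenvalue_div_pow]
    have h := tendsto_natCast_smul_sub (hasDerivAt_angle k) c
    have hc : Continuous fun x : ℝ => Complex.exp ((-1) ^ (i : ℕ) * (x : ℂ) * Complex.I) := by
      fun_prop
    exact (hc.tendsto _).comp h
  · refine tendsto_pi_nhds.2 fun a => tendsto_pi_nhds.2 fun b => ?_
    have hP : Tendsto (fun d : ℕ => spectralProj (k + c / d) i - spectralProj k i) atTop (𝓝 0) := by
      have := ((continuous_spectralProj i).tendsto k).comp hl
      simpa using this.sub_const (spectralProj k i)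
    have hP' : ∀ c', Tendsto (fun d : ℕ =>
        ‖(spectralProj (k + c / d) i - spectralProj k i) c' b‖) atTop (𝓝 0) := by
      intro c'
      have := (tendsto_pi_nhds.1 (tendsto_pi_nhds.1 hP c') b).norm
      simpa using this
    have hsum : Tendsto (fun d : ℕ => ∑ c', ‖(spectralProj (k + c / d) i - spectralProj k i) c' b‖)
        atTop (𝓝 0) := by
      simpa using tendsto_finsetSum Finset.univ fun c' _ => hP' c'
    refine squeeze_zero_norm (fun d => ?_) hsum
    rw [Matrix.smul_apply, norm_smul, norm_pow, norm_eigenvalue, one_pow, one_mul, Matrix.mul_apply]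
    refine (norm_sum_le _ _).trans (Finset.sum_le_sum fun c' _ => ?_)
    rw [norm_mul]
    refine mul_le_of_le_one_left (norm_nonneg _) ?_
    exact entry_norm_bound_of_unitary (Unitary.star_mem (Hhat_pow_mem_unitaryGroup d k)) a c'

/-- The weight of the first eigenvector of `Ĥ(k)` in `φ₀`. -/
noncomputable def eigenWeight (k : ℝ) : ℝ :=
  (1 - Real.sin k / Real.sqrt (1 + Real.cos k ^ 2)) / 2

lemma phi0_dotProduct_Hhat (k : ℝ) :
    star phi0 ⬝ᵥ (Hhat k).mulVec phi0 = (Complex.I - 1) * Real.sin (angle k) := by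
  have h2 : ((Real.sqrt 2 : ℝ) : ℂ) * ((Real.sqrt 2 : ℝ) : ℂ) = 2 := by
    rw [← Complex.ofReal_mul, Real.mul_self_sqrt (by norm_num)]; norm_num
  have h0 : ((Real.sqrt 2 : ℝ) : ℂ) ≠ 0 := by
    intro h; rw [h] at h2; norm_num at h2
  have a1 : Complex.I * k * ((1 : ℤ) : ℂ) = k * Complex.I := by push_cast; ring
  have a2 : Complex.I * k * ((-1 : ℤ) : ℂ) = -k * Complex.I := by push_cast; ring
  have e2 : (Real.sin k : ℂ) = (Complex.exp (-k * Complex.I) - Complex.exp (k * Complex.I))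
      * Complex.I / 2 := by rw [Complex.ofReal_sin, Complex.sin]
  rw [sin_angle, Complex.ofReal_div, e2]
  simp only [dotProduct, Matrix.mulVec, Fin.sum_univ_two, Hhat_apply, shift, hadamard, phi0,
    Matrix.smul_apply, Matrix.of_apply, Matrix.cons_val', Pi.star_apply,
    Matrix.cons_val_zero, Matrix.cons_val_one, smul_eq_mul, Matrix.cons_val_fin_one, a1, a2]
  simp
  field_simp
  rw [sq, h2]
  generalize Complex.exp (-(k * Complex.I)) = u
  generalize Complex.exp (k * Complex.I) = v
  linear_combination 2 * v * Complex.I_sq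

lemma phi0_dotProduct_phi0 : star phi0 ⬝ᵥ phi0 = 1 := by
  have h := overlap_self 0 phi0 0
  rw [overlap_eq_dotProduct, sum_norm_sq_phi0] at h
  simpa using h

lemma phi0_dotProduct_spectralProj_zero (k : ℝ) :
    star phi0 ⬝ᵥ (spectralProj k 0).mulVec phi0 = eigenWeight k := by
  have hc := (cos_angle_pos k).ne'
  have hc' : (Real.cos (angle k) : ℂ) ≠ 0 := by exact_mod_cast hc
  -- The weight is `(1 - tan α)/2`, the form produced by `⟨φ₀, Ĥφ₀⟩ = (i - 1) sin α` and `λ₁ = -cos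
  -- α + i sin α`.
  have hw : eigenWeight k = (1 - Real.sin (angle k) / Real.cos (angle k)) / 2 := by
    have := one_add_cos_sq_pos k
    rw [eigenWeight, sin_angle, cos_angle]
    congr 2
    field_simp
  have he : eigenvalue k 1 = -(Real.cos (angle k) - Real.sin (angle k) * Complex.I) := by
    simp only [eigenvalue, Matrix.cons_val_one, Matrix.cons_val_fin_one]
    rw [← Complex.ofReal_neg, Complex.exp_mul_I, ← Complex.ofReal_cos, ← Complex.ofReal_sin,
      Real.cos_neg, Real.sin_neg]
    push_cast
    ring
  simp only [spectralProj, Matrix.cons_val_zero]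
  rw [Matrix.smul_mulVec, dotProduct_smul, Matrix.sub_mulVec, dotProduct_sub,
    phi0_dotProduct_Hhat, Matrix.smul_mulVec, Matrix.one_mulVec, dotProduct_smul,
    phi0_dotProduct_phi0, eigenvalue_zero_sub_one, he, hw]
  simp only [smul_eq_mul]
  push_cast at hc' ⊢
  field_simp
  ring

lemma phi0_dotProduct_spectralProj_one (k : ℝ) :
    star phi0 ⬝ᵥ (spectralProj k 1).mulVec phi0 = 1 - eigenWeight k := by
  rw [← phi0_dotProduct_spectralProj_zero, ← phi0_dotProduct_phi0, eq_sub_iff_add_eq,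
    ← dotProduct_add, ← Matrix.add_mulVec, add_comm, spectralProj_add, Matrix.one_mulVec]

lemma trace_spectralProj_zero (k : ℝ) : (spectralProj k 0).trace = 1 := by
  simp only [spectralProj, Matrix.cons_val_zero]
  rw [Matrix.trace_smul, Matrix.trace_sub, Matrix.trace_smul, Matrix.trace_one,
    ← eigenvalue_add, smul_eq_mul, smul_eq_mul, inv_mul_eq_one₀ (eigenvalue_zero_sub_one_ne_zero k)]
  simp
  ring

lemma trace_spectralProj_one (k : ℝ) : (spectralProj k 1).trace = 1 := by
  have h := congrArg Matrix.trace (spectralProj_add k)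
  rw [Matrix.trace_add, trace_spectralProj_zero, Matrix.trace_one] at h
  simp at h
  linear_combination h

lemma tendsto_overlap (k c : ℝ) :
    Tendsto (fun d : ℕ => overlap d phi0 k (k + c / d)) atTop
      (𝓝 (eigenWeight k * Complex.exp (c * speed k * Complex.I) +
        (1 - eigenWeight k) * Complex.exp (-(c * speed k * Complex.I)))) := by
  have hcont : Continuous fun W : Matrix (Fin 2) (Fin 2) ℂ => star phi0 ⬝ᵥ W.mulVec phi0 :=
    Continuous.dotProduct continuous_const (Continuous.matrix_mulVec continuous_id continuous_const)
  have h := (hcont.tendsto _).comp (tendsto_star_Hhat_pow_mul_Hhat_pow k c)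
  simp only [Function.comp_def, ← overlap_eq_dotProduct, Fin.sum_univ_two, Matrix.add_mulVec,
    dotProduct_add, Matrix.smul_mulVec, dotProduct_smul, phi0_dotProduct_spectralProj_zero,
    phi0_dotProduct_spectralProj_one] at h
  convert h using 3
  · simp [mul_comm]
  · simp [mul_comm]

lemma tendsto_meanOverlap (k c : ℝ) :
    Tendsto (fun d : ℕ => meanOverlap d k (k + c / d)) atTop
      (𝓝 (1 / 2 * Complex.exp (c * speed k * Complex.I) +
        1 / 2 * Complex.exp (-(c * speed k * Complex.I)))) := by
  have hcont : Continuous fun W : Matrix (Fin 2) (Fin 2) ℂ => 1 / 2 * W.trace :=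
    continuous_const.mul (Continuous.matrix_trace continuous_id)
  have h := (hcont.tendsto _).comp (tendsto_star_Hhat_pow_mul_Hhat_pow k c)
  simp only [Function.comp_def, ← meanOverlap_eq_trace, Fin.sum_univ_two, Matrix.trace_add,
    Matrix.trace_smul, trace_spectralProj_zero, trace_spectralProj_one] at h
  convert h using 2
  simp
  ring

/-! ### The limit density -/

/-- The variable `x = -speed k` is chosen because it increases on `(0, π)` and pairs `𝒫(x)` with the
phase of positive frequency. -/
lemma hasDerivAt_neg_speed (k : ℝ) :
    HasDerivAt (fun k => -speed k)
      (Real.sin k / ((1 + Real.cos k ^ 2) * Real.sqrt (1 + Real.cos k ^ 2))) k := by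
  have hp := one_add_cos_sq_pos k
  have hc := Real.hasDerivAt_cos k
  have hs := ((hc.pow 2).const_add 1).sqrt hp.ne'
  have h := (hc.div hs (Real.sqrt_pos.2 hp).ne').neg
  refine h.congr_deriv ?_
  have h2 : Real.sqrt (1 + Real.cos k ^ 2) ^ 2 = 1 + Real.cos k ^ 2 := Real.sq_sqrt hp.le
  have h3 := (Real.sqrt_pos.2 hp).ne'
  simp only [Pi.pow_apply, h2]
  field_simp
  rw [h2]
  push_cast
  ring

lemma sqrt_one_sub_two_mul_speed_sq (k : ℝ) :
    Real.sqrt (1 - 2 * speed k ^ 2) = |Real.sin k| / Real.sqrt (1 + Real.cos k ^ 2) := by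
  have hp := one_add_cos_sq_pos k
  rw [← Real.sqrt_sq_eq_abs, ← Real.sqrt_div (sq_nonneg _)]
  congr 1
  rw [speed, div_pow, Real.sq_sqrt hp.le, Real.sin_sq]
  field_simp
  ring

lemma strictMonoOn_neg_speed : StrictMonoOn (fun k => -speed k) (Set.Ioo 0 Real.pi) := by
  refine strictMonoOn_of_deriv_pos (convex_Ioo _ _)
    (fun k _ => (hasDerivAt_neg_speed k).continuousAt.continuousWithinAt) fun k hk => ?_
  rw [interior_Ioo] at hk
  rw [(hasDerivAt_neg_speed k).deriv]
  have hp := one_add_cos_sq_pos k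
  have := Real.sin_pos_of_mem_Ioo hk
  positivity

lemma image_neg_speed :
    (fun k => -speed k) '' Set.Ioo 0 Real.pi
      = Set.Ioo (-(1 / Real.sqrt 2)) (1 / Real.sqrt 2) := by
  have hmem : ∀ x : ℝ, x ∈ Set.Ioo (-(1 / Real.sqrt 2)) (1 / Real.sqrt 2) ↔ x ^ 2 < 1 / 2 := by
    intro x
    rw [Set.mem_Ioo, ← abs_lt, ← sq_lt_sq₀ (abs_nonneg _) (by positivity), sq_abs, div_pow,
      Real.sq_sqrt (by norm_num)]
    norm_num
  ext x
  rw [hmem]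
  constructor
  · rintro ⟨k, hk, rfl⟩
    have hp := one_add_cos_sq_pos k
    have hs := Real.sin_pos_of_mem_Ioo hk
    simp only [neg_sq]
    rw [speed, div_pow, Real.sq_sqrt hp.le, div_lt_div_iff₀ hp (by norm_num)]
    nlinarith [Real.sin_sq_add_cos_sq k]
  · intro hx
    have h1 : 0 < 1 - x ^ 2 := by linarith
    have hs1 := Real.sqrt_pos.2 h1
    have hsq : (-x / Real.sqrt (1 - x ^ 2)) ^ 2 < 1 := by
      rw [div_pow, Real.sq_sqrt h1.le, div_lt_one h1]
      linarith
    obtain ⟨hl, hu⟩ := abs_lt.1 (sq_lt_one_iff_abs_lt_one _ |>.1 hsq)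
    -- Solving `-cos k / √(1 + cos² k) = x` for the cosine gives `cos k = -x / √(1 - x²)`.
    refine ⟨Real.arccos (-x / Real.sqrt (1 - x ^ 2)), ⟨Real.arccos_pos.2 hu, ?_⟩, ?_⟩
    · refine lt_of_le_of_ne (Real.arccos_le_pi _) fun h => ?_
      rw [Real.arccos_eq_pi] at h
      linarith
    · simp only [speed, Real.cos_arccos hl.le hu.le]
      have : 1 + (-x / Real.sqrt (1 - x ^ 2)) ^ 2 = (1 / Real.sqrt (1 - x ^ 2)) ^ 2 := by
        rw [div_pow, div_pow, Real.sq_sqrt h1.le]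
        field_simp
        ring
      rw [this, Real.sqrt_sq (by positivity)]
      field_simp

/-- The Jacobian of `k ↦ -speed k` cancels Konno's density up to the constant `1/π`. Hence that
density is the image of the uniform law on `(0, π)`. -/
lemma deriv_mul_konno {k : ℝ} (hk : k ∈ Set.Ioo 0 Real.pi) :
    |Real.sin k / ((1 + Real.cos k ^ 2) * Real.sqrt (1 + Real.cos k ^ 2))| * konno (-speed k)
      = Real.pi⁻¹ := by
  have hp := one_add_cos_sq_pos k
  have hr := Real.sqrt_pos.2 hp
  have hs := Real.sin_pos_of_mem_Ioo hk
  have h1 : 1 - speed k ^ 2 = 1 / (1 + Real.cos k ^ 2) := by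
    rw [speed, div_pow, Real.sq_sqrt hp.le]
    field_simp
    ring
  have hmem : -speed k ∈ Set.Ioo (-(1 / Real.sqrt 2)) (1 / Real.sqrt 2) := by
    rw [← image_neg_speed]
    exact ⟨k, hk, rfl⟩
  rw [abs_of_pos (by positivity), konno, Set.indicator_of_mem hmem, neg_sq,
    sqrt_one_sub_two_mul_speed_sq, h1, abs_of_pos hs]
  have := Real.pi_pos
  field_simp

lemma konno_smul_eq_indicator (G : ℝ → ℂ) :
    (fun x => (konno x : ℂ) * G x)
      = (Set.Ioo (-(1 / Real.sqrt 2)) (1 / Real.sqrt 2)).indicator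
          fun x => (konno x : ℂ) * G x := by
  funext x
  by_cases hx : x ∈ Set.Ioo (-(1 / Real.sqrt 2)) (1 / Real.sqrt 2)
  · rw [Set.indicator_of_mem hx]
  · rw [Set.indicator_of_notMem hx, konno, Set.indicator_of_notMem hx]
    simp

lemma deriv_smul_konno (G : ℝ → ℂ) {k : ℝ} (hk : k ∈ Set.Ioo 0 Real.pi) :
    |Real.sin k / ((1 + Real.cos k ^ 2) * Real.sqrt (1 + Real.cos k ^ 2))| •
      ((konno (-speed k) : ℂ) * G (-speed k)) = (Real.pi⁻¹ : ℝ) * G (-speed k) := by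
  rw [Complex.real_smul, ← mul_assoc, ← Complex.ofReal_mul, deriv_mul_konno hk]

lemma integral_konno_mul (G : ℝ → ℂ) :
    ∫ x, (konno x : ℂ) * G x
      = (Real.pi⁻¹ : ℝ) * ∫ k in (0 : ℝ)..Real.pi, G (-speed k) := by
  rw [konno_smul_eq_indicator, integral_indicator measurableSet_Ioo, ← image_neg_speed,
    integral_image_eq_integral_abs_deriv_smul measurableSet_Ioo
      (fun k _ => (hasDerivAt_neg_speed k).hasDerivWithinAt) strictMonoOn_neg_speed.injOn,
    setIntegral_congr_fun measurableSet_Ioo (fun k hk => deriv_smul_konno G hk),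
    integral_const_mul, intervalIntegral.integral_of_le Real.pi_pos.le,
    integral_Ioc_eq_integral_Ioo]

lemma continuous_speed : Continuous speed := by
  have h : ∀ k, Real.sqrt (1 + Real.cos k ^ 2) ≠ 0 := fun k =>
    (Real.sqrt_pos.2 (one_add_cos_sq_pos k)).ne'
  exact Real.continuous_cos.div (by fun_prop) h

/-- The density is unbounded at the ends of its interval. In the variable `k` the singularities
disappear and a continuous function on a bounded interval remains. -/
lemma integrable_konno_mul {G : ℝ → ℂ} (hG : Continuous G) :
    Integrable fun x => (konno x : ℂ) * G x := by
  rw [konno_smul_eq_indicator, integrable_indicator_iff measurableSet_Ioo, ← image_neg_speed,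
    integrableOn_image_iff_integrableOn_abs_deriv_smul measurableSet_Ioo
      (fun k _ => (hasDerivAt_neg_speed k).hasDerivWithinAt) strictMonoOn_neg_speed.injOn,
    integrableOn_congr_fun (fun k hk => deriv_smul_konno G hk) measurableSet_Ioo]
  have hc : Continuous fun k => ((Real.pi⁻¹ : ℝ) : ℂ) * G (-speed k) :=
    continuous_const.mul (hG.comp continuous_speed.neg)
  exact (hc.integrableOn_Icc (a := 0) (b := Real.pi)).mono_set Set.Ioo_subset_Icc_self

lemma konno_nonneg (x : ℝ) : 0 ≤ konno x := by
  refine Set.indicator_nonneg (fun y hy => ?_) x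
  have hy2 : y ^ 2 < 1 / 2 := by
    rw [Set.mem_Ioo, ← abs_lt, ← sq_lt_sq₀ (abs_nonneg _) (by positivity), sq_abs, div_pow,
      Real.sq_sqrt (by norm_num)] at hy
    simpa using hy
  have : 0 < 1 - y ^ 2 := by linarith
  have := Real.pi_pos
  positivity

lemma konno_neg (x : ℝ) : konno (-x) = konno x := by
  by_cases hx : x ∈ Set.Ioo (-(1 / Real.sqrt 2)) (1 / Real.sqrt 2)
  · have hx' : -x ∈ Set.Ioo (-(1 / Real.sqrt 2)) (1 / Real.sqrt 2) :=
      ⟨by linarith [hx.2], by linarith [hx.1]⟩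
    rw [konno, konno, Set.indicator_of_mem hx, Set.indicator_of_mem hx', neg_sq]
  · have hx' : -x ∉ Set.Ioo (-(1 / Real.sqrt 2)) (1 / Real.sqrt 2) := fun h =>
      hx ⟨by linarith [h.2], by linarith [h.1]⟩
    rw [konno, konno, Set.indicator_of_notMem hx, Set.indicator_of_notMem hx']

lemma slope_pos {M j : ℕ} (hM : 1 ≤ M) (hj : 2 * j ≠ M) : 0 < slope M j := by
  have hM' : (M : ℝ) ≠ 0 := by positivity
  refine abs_pos.2 fun h => hj ?_
  field_simp at h
  have : (2 * j : ℝ) = M := by linarith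
  exact_mod_cast this

/-- The Fourier integral of an even function does not see the sign of the frequency. -/
lemma integral_mul_exp_abs {h : ℝ → ℝ} (heven : ∀ x, h (-x) = h x) (θ s : ℝ) :
    ∫ x, (h x : ℂ) * Complex.exp (θ * (|s| * x : ℝ) * Complex.I)
      = ∫ x, (h x : ℂ) * Complex.exp (θ * (s * x : ℝ) * Complex.I) := by
  rcases abs_choice s with hs | hs
  · rw [hs]
  · rw [hs, ← integral_neg_eq_self]
    simp only [heven, neg_mul_neg]

/-! ### Mixtures of rescaled even densities with an atom -/

section Mixture

variable {M : ℕ} {h : ℕ → ℝ → ℝ} (hM : 1 ≤ M) (h0 : ∀ j x, 0 ≤ h j x)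
  (hint : ∀ j, Integrable (h j)) (heven : ∀ j x, h j (-x) = h j x)
  (hsum : ∑ j ∈ Finset.range (M + 1), ∫ x, h j x = 1)

include hM hint in
lemma integrable_rescaled_sum : Integrable fun x =>
    ∑ j ∈ (Finset.range (M + 1)).filter (fun j => 2 * j ≠ M),
      h j (x / slope M j) / slope M j := by
  refine integrable_finsetSum _ fun j hj => ?_
  exact ((hint j).comp_div (slope_pos hM (Finset.mem_filter.1 hj).2).ne').div_const _

include hM hint heven in
-- The substitution `y = x / slope` moves the scale into the frequency. Evenness then replaces `|1 -
-- 2j/M|` by the signed factor.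
lemma integral_rescaled_sum_mul_exp (θ : ℝ) :
    ∫ x, ((∑ j ∈ (Finset.range (M + 1)).filter (fun j => 2 * j ≠ M),
        h j (x / slope M j) / slope M j : ℝ) : ℂ) * Complex.exp (θ * x * Complex.I)
      = ∑ j ∈ (Finset.range (M + 1)).filter (fun j => 2 * j ≠ M),
          ∫ x, (h j x : ℂ) *
            Complex.exp (θ * ((1 - 2 * (j : ℝ) / M) * x : ℝ) * Complex.I) := by
  simp only [Complex.ofReal_sum, Finset.sum_mul]
  rw [integral_finsetSum]
  · refine Finset.sum_congr rfl fun j hj => ?_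
    have hs := slope_pos hM (Finset.mem_filter.1 hj).2
    rw [← integral_mul_exp_abs (heven j)]
    change _ = ∫ x, (h j x : ℂ) * Complex.exp (θ * (slope M j * x : ℝ) * Complex.I)
    have hcomp := Measure.integral_comp_div (fun y => ((slope M j)⁻¹ : ℝ) *
      ((h j y : ℂ) * Complex.exp (θ * (slope M j * y : ℝ) * Complex.I))) (slope M j)
    have hconst : ∫ y, ((slope M j)⁻¹ : ℝ) *
        ((h j y : ℂ) * Complex.exp (θ * (slope M j * y : ℝ) * Complex.I)) = ((slope M j)⁻¹ : ℝ) *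
        ∫ y, (h j y : ℂ) * Complex.exp (θ * (slope M j * y : ℝ) * Complex.I) :=
      integral_const_mul _ _
    rw [abs_of_pos hs, hconst, Complex.real_smul, ← mul_assoc, ← Complex.ofReal_mul,
      mul_inv_cancel₀ hs.ne', Complex.ofReal_one, one_mul] at hcomp
    rw [← hcomp]
    congr 1
    funext x
    rw [mul_div_cancel₀ _ hs.ne']
    push_cast
    ring
  · intro j hj
    have hi := (((hint j).comp_div (slope_pos hM (Finset.mem_filter.1 hj).2).ne').div_const
      (slope M j)).ofReal (𝕜 := ℂ)
    refine hi.mul_bdd (c := 1) (Continuous.aestronglyMeasurable (by fun_prop))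
      (ae_of_all _ fun x => ?_)
    rw [← Complex.ofReal_mul, Complex.norm_exp_ofReal_mul_I]

include hsum in
-- The only omitted index is `j = M/2`, present exactly for even `M`. Its mass is what the others
-- lack to `1`, hence the weight of the atom.
lemma sum_filter_add_atom (F : ℕ → ℂ)
    (hF : ∀ j, 2 * j = M → F j = ((∫ x, h j x : ℝ) : ℂ)) :
    ∑ j ∈ Finset.range (M + 1), F j
      = ∑ j ∈ (Finset.range (M + 1)).filter (fun j => 2 * j ≠ M), F j +
        if Even M then ((1 - ∑ j ∈ (Finset.range (M + 1)).filter (fun j => 2 * j ≠ M),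
          ∫ x, h j x : ℝ) : ℂ) else 0 := by
  rw [← Finset.sum_filter_add_sum_filter_not _ (fun j => 2 * j ≠ M)]
  congr 1
  rw [← hsum, ← Finset.sum_filter_add_sum_filter_not (Finset.range (M + 1)) (fun j => 2 * j ≠ M)
    (fun j => ∫ x, h j x), add_sub_cancel_left]
  simp only [not_not]
  split_ifs with he
  · rw [Complex.ofReal_sum]
    exact Finset.sum_congr rfl fun j hj => hF j (Finset.mem_filter.1 hj).2
  · refine Finset.sum_eq_zero fun j hj => absurd ⟨j, ?_⟩ he
    rw [← (Finset.mem_filter.1 hj).2]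
    ring

include hM h0 hint heven hsum in
/-- A mixture of rescaled even densities `h j`, the part of slope zero being an atom. -/
lemma withAtom_rescaled_sum {f : ℝ → ℝ}
    (hf : ∀ x, f x = ∑ j ∈ (Finset.range (M + 1)).filter (fun j => 2 * j ≠ M),
      h j (x / slope M j) / slope M j) :
    IsProbabilityMeasure (withAtom M f) ∧ ∀ θ : ℝ, charFun (withAtom M f) θ
      = ∑ j ∈ Finset.range (M + 1), ∫ x, (h j x : ℂ) *
          Complex.exp (θ * ((1 - 2 * (j : ℝ) / M) * x : ℝ) * Complex.I) := by
  obtain rfl : f = fun x => _ := funext hf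
  set S := (Finset.range (M + 1)).filter (fun j => 2 * j ≠ M) with hS
  set f : ℝ → ℝ := fun x => ∑ j ∈ S, h j (x / slope M j) / slope M j with hfdef
  have hfi : Integrable f := integrable_rescaled_sum hM hint
  have hf0 : ∀ x, 0 ≤ f x := fun x =>
    Finset.sum_nonneg fun j _ => div_nonneg (h0 _ _) (abs_nonneg _)
  have hexp := integral_rescaled_sum_mul_exp hM hint heven
  -- The mass is the Fourier integral at frequency zero.
  have hmass : ∫ x, f x = ∑ j ∈ S, ∫ x, h j x := by
    have h1 := hexp 0
    simp only [Complex.ofReal_zero, zero_mul, Complex.exp_zero, mul_one] at h1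
    rw [integral_complex_ofReal] at h1
    simp only [integral_complex_ofReal] at h1
    exact_mod_cast h1
  have hlint : ∫⁻ x, ENNReal.ofReal (f x) = ENNReal.ofReal (∑ j ∈ S, ∫ x, h j x) := by
    rw [← hmass, ofReal_integral_eq_lintegral_ofReal hfi (ae_of_all _ hf0)]
  have hm0 : 0 ≤ ∑ j ∈ S, ∫ x, h j x :=
    Finset.sum_nonneg fun j _ => integral_nonneg (h0 j)
  have hm1 : ∑ j ∈ S, ∫ x, h j x ≤ 1 := by
    rw [← hsum]
    exact Finset.sum_le_sum_of_subset_of_nonneg (Finset.filter_subset _ _)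
      fun j _ _ => integral_nonneg (h0 j)
  -- The weight of the atom is a truncated difference in `[0, ∞]`. Since the mass of the density is
  -- at most `1`, nothing is lost on passing to a real number.
  have hatom : withAtom M f = volume.withDensity (fun x => ENNReal.ofReal (f x)) +
      ENNReal.ofReal (if Even M then 1 - ∑ j ∈ S, ∫ x, h j x else 0) • Measure.dirac 0 := by
    rw [withAtom, hlint]
    congr 2
    split_ifs
    · rw [ENNReal.ofReal_sub _ hm0, ENNReal.ofReal_one]
    · simp
  have hw0 : 0 ≤ (if Even M then 1 - ∑ j ∈ S, ∫ x, h j x else 0) := by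
    split_ifs
    · linarith
    · exact le_rfl
  have htotal : (∑ j ∈ S, ∫ x, h j x) + (if Even M then 1 - ∑ j ∈ S, ∫ x, h j x else 0) = 1 := by
    have h1 := sum_filter_add_atom hsum (fun j => ((∫ x, h j x : ℝ) : ℂ)) fun _ _ => rfl
    rw [← Complex.ofReal_sum, hsum] at h1
    rw [← Complex.ofReal_sum, ← hS] at h1
    split_ifs at h1 ⊢ <;> exact_mod_cast h1.symm
  have hfin : IsFiniteMeasure (volume.withDensity fun x => ENNReal.ofReal (f x)) := by
    refine isFiniteMeasure_withDensity ?_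
    rw [hlint]
    exact ENNReal.ofReal_ne_top
  have hfin' : IsFiniteMeasure (ENNReal.ofReal (if Even M then 1 - ∑ j ∈ S, ∫ x, h j x else 0) •
      (Measure.dirac 0 : Measure ℝ)) := Measure.smul_finite _ ENNReal.ofReal_ne_top
  refine ⟨⟨?_⟩, fun θ => ?_⟩
  · rw [hatom, Measure.add_apply, withDensity_apply _ MeasurableSet.univ, Measure.restrict_univ,
      hlint, Measure.smul_apply, measure_univ, smul_eq_mul, mul_one, ← ENNReal.ofReal_add hm0 hw0,
      htotal, ENNReal.ofReal_one]
  · have hb : ∀ x : ℝ, ‖Complex.exp (θ * x * Complex.I)‖ ≤ 1 := fun x => by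
      rw [← Complex.ofReal_mul, Complex.norm_exp_ofReal_mul_I]
    rw [hatom, charFun_apply_real, integral_add_measure, integral_smul_measure, integral_dirac,
      integral_withDensity_eq_integral_toReal_smul₀ hfi.1.aemeasurable.ennreal_ofReal
        (ae_of_all _ fun x => ENNReal.ofReal_lt_top)]
    · simp only [ENNReal.toReal_ofReal (hf0 _), ENNReal.toReal_ofReal hw0, Complex.real_smul]
      rw [hexp, sum_filter_add_atom hsum]
      · congr 1
        rw [← hS]
        split_ifs <;> simp
      · intro j hj
        have hM' : (M : ℝ) ≠ 0 := by positivity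
        have : 1 - 2 * (j : ℝ) / M = 0 := by
          rw [← hj] at hM' ⊢
          push_cast at hM' ⊢
          rw [div_self hM', sub_self]
        simp [this, integral_complex_ofReal]
    · exact Integrable.of_bound (Continuous.aestronglyMeasurable (by fun_prop)) 1 (ae_of_all _ hb)
    · exact Integrable.of_bound (Continuous.aestronglyMeasurable (by fun_prop)) 1 (ae_of_all _ hb)

end Mixture

/-! ### Konno's density with binomial weights -/

section Weights

variable {M : ℕ} {a b : ℝ → ℝ} (ha : Continuous a) (hb : Continuous b)

include ha hb in
-- The binomial theorem expands the `M`-th power of a two-point characteristic function: choosing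
-- the second point `j` times gives weight `a^(M-j) b^j` and frequency `M - 2j`.
lemma integral_konno_mul_pow (c : ℝ) :
    ∑ j ∈ Finset.range (M + 1), ∫ x, ((M.choose j * konno x * a x ^ (M - j) * b x ^ j : ℝ) : ℂ) *
        Complex.exp (((M - 2 * j : ℝ) * c * x : ℝ) * Complex.I)
      = (Real.pi⁻¹ : ℝ) * ∫ k in (0 : ℝ)..Real.pi,
          (a (-speed k) * Complex.exp ((c * -speed k : ℝ) * Complex.I) +
            b (-speed k) * Complex.exp (-((c * -speed k : ℝ) * Complex.I))) ^ M := by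
  rw [← integral_konno_mul fun x => (a x * Complex.exp ((c * x : ℝ) * Complex.I) +
    b x * Complex.exp (-((c * x : ℝ) * Complex.I))) ^ M, ← integral_finsetSum]
  · congr 1
    funext x
    rw [add_comm (_ * _ : ℂ), add_pow, Finset.mul_sum]
    refine Finset.sum_congr rfl fun j hj => ?_
    have hj' : j ≤ M := Nat.lt_succ_iff.1 (Finset.mem_range.1 hj)
    rw [mul_pow, mul_pow, ← Complex.exp_nat_mul, ← Complex.exp_nat_mul]
    have he : Complex.exp (((M - 2 * j : ℝ) * c * x : ℝ) * Complex.I)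
        = Complex.exp (j * -((c * x : ℝ) * Complex.I)) *
          Complex.exp ((M - j : ℕ) * ((c * x : ℝ) * Complex.I)) := by
      rw [← Complex.exp_add]
      congr 1
      push_cast [hj']
      ring
    rw [he]
    push_cast
    ring
  · intro j _
    have hG : Continuous fun x : ℝ => ((M.choose j * a x ^ (M - j) * b x ^ j : ℝ) : ℂ) *
        Complex.exp (((M - 2 * j : ℝ) * c * x : ℝ) * Complex.I) := by fun_prop
    refine (integrable_konno_mul hG).congr (ae_of_all _ fun x => ?_)
    push_cast
    ring

include ha hb in
/-- The mixture of the rescaled Konno densities with binomial weights. -/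
lemma withAtom_binomial (hM : 1 ≤ M) (ha0 : ∀ x, 0 ≤ a x) (hb0 : ∀ x, 0 ≤ b x)
    (hab : ∀ x, a x + b x = 1) (haeven : ∀ x, a (-x) = a x) (hbeven : ∀ x, b (-x) = b x)
    {f : ℝ → ℝ}
    (hf : ∀ x, f x = ∑ j ∈ (Finset.range (M + 1)).filter (fun j => 2 * j ≠ M),
      (M.choose j * konno (x / slope M j) * a (x / slope M j) ^ (M - j) *
        b (x / slope M j) ^ j) / slope M j) :
    IsProbabilityMeasure (withAtom M f) ∧ ∀ θ : ℝ, charFun (withAtom M f) θ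
      = (Real.pi⁻¹ : ℝ) * ∫ k in (0 : ℝ)..Real.pi,
          (a (-speed k) * Complex.exp ((θ / M * -speed k : ℝ) * Complex.I) +
            b (-speed k) * Complex.exp (-((θ / M * -speed k : ℝ) * Complex.I))) ^ M := by
  have hM' : (M : ℝ) ≠ 0 := by positivity
  have hMC : (M : ℂ) ≠ 0 := by exact_mod_cast hM'
  -- At frequency zero the expanded power is `(a + b)^M = 1`, so the masses add up to the mean of
  -- `1` over `(0, π)`.
  have hsum : ∑ j ∈ Finset.range (M + 1), ∫ x, M.choose j * konno x * a x ^ (M - j) * b x ^ j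
      = 1 := by
    have h := integral_konno_mul_pow (M := M) ha hb 0
    have hab' : ∀ x, (a x : ℂ) + b x = 1 := fun x => by exact_mod_cast hab x
    simp only [mul_zero, zero_mul, Complex.ofReal_zero, neg_zero, Complex.exp_zero, mul_one,
      integral_complex_ofReal, hab', one_pow, intervalIntegral.integral_const, sub_zero] at h
    have hpi := Real.pi_pos.ne'
    rw [Complex.real_smul, mul_one, ← Complex.ofReal_mul, inv_mul_cancel₀ hpi,
      ← Complex.ofReal_sum] at h
    exact_mod_cast h
  have hint : ∀ j, Integrable fun x => M.choose j * konno x * a x ^ (M - j) * b x ^ j := by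
    intro j
    have hG : Continuous fun x : ℝ => ((M.choose j * a x ^ (M - j) * b x ^ j : ℝ) : ℂ) := by
      fun_prop
    refine (integrable_konno_mul hG).re.congr (ae_of_all _ fun x => ?_)
    simp only [← Complex.ofReal_mul, RCLike.re_to_complex, Complex.ofReal_re]
    ring
  obtain ⟨hp, hc⟩ := withAtom_rescaled_sum
    (h := fun j x => M.choose j * konno x * a x ^ (M - j) * b x ^ j) hM
    (fun j x => mul_nonneg (mul_nonneg (mul_nonneg (Nat.cast_nonneg _) (konno_nonneg x))
      (pow_nonneg (ha0 x) _)) (pow_nonneg (hb0 x) _)) hint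
    (fun j x => by simp only [konno_neg, haeven, hbeven]) hsum hf
  refine ⟨hp, fun θ => ?_⟩
  rw [hc, ← integral_konno_mul_pow ha hb]
  refine Finset.sum_congr rfl fun j _ => ?_
  congr 1
  funext x
  congr 3
  push_cast
  field_simp

end Weights

/-! ### Characteristic functions of the limit laws and convergence for fixed `M` -/

lemma continuous_weightP : Continuous weightP := by
  unfold weightP
  fun_prop

lemma continuous_weightQ : Continuous weightQ := by
  unfold weightQ
  fun_prop

lemma weightP_nonneg (x : ℝ) : 0 ≤ weightP x := by
  unfold weightP
  positivity

lemma weightQ_nonneg (x : ℝ) : 0 ≤ weightQ x := by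
  have : Real.sqrt (1 - 2 * x ^ 2) ≤ 1 := Real.sqrt_le_one.2 (by nlinarith [sq_nonneg x])
  unfold weightQ
  linarith

lemma limitA_spec {M : ℕ} (hM : 1 ≤ M) :
    IsProbabilityMeasure (limitA M) ∧ ∀ θ : ℝ, charFun (limitA M) θ
      = (Real.pi⁻¹ : ℝ) * ∫ k in (0 : ℝ)..Real.pi,
          (weightP (-speed k) * Complex.exp ((θ / M * -speed k : ℝ) * Complex.I) +
            weightQ (-speed k) * Complex.exp (-((θ / M * -speed k : ℝ) * Complex.I))) ^ M := by
  refine withAtom_binomial continuous_weightP continuous_weightQ hM weightP_nonneg weightQ_nonneg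
    (fun x => by unfold weightP weightQ; ring) (fun x => by simp only [weightP, neg_sq])
    (fun x => by simp only [weightQ, neg_sq]) fun x => ?_
  exact Finset.sum_congr rfl fun j _ => by ring

lemma limitB_spec {M : ℕ} (hM : 1 ≤ M) :
    IsProbabilityMeasure (limitB M) ∧ ∀ θ : ℝ, charFun (limitB M) θ
      = (Real.pi⁻¹ : ℝ) * ∫ k in (0 : ℝ)..Real.pi,
          (((1 / 2 : ℝ) : ℂ) * Complex.exp ((θ / M * -speed k : ℝ) * Complex.I) +
            ((1 / 2 : ℝ) : ℂ) * Complex.exp (-((θ / M * -speed k : ℝ) * Complex.I))) ^ M := by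
  refine withAtom_binomial (a := fun _ => 1 / 2) (b := fun _ => 1 / 2) continuous_const
    continuous_const hM (fun _ => by norm_num) (fun _ => by norm_num) (fun _ => by norm_num)
    (fun _ => rfl) (fun _ => rfl) fun x => ?_
  rw [densityB, Finset.mul_sum]
  refine Finset.sum_congr rfl fun j hj => ?_
  have hj' : j ≤ M := Nat.lt_succ_iff.1 (Finset.mem_range.1 (Finset.mem_filter.1 hj).1)
  rw [mul_assoc _ ((1 / 2 : ℝ) ^ (M - j)), ← pow_add, Nat.sub_add_cancel hj']
  ring

lemma integral_uniformAngle_of_periodic {F : ℝ → ℂ} (hF : Continuous F)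
    (hper : Function.Periodic F Real.pi) :
    ∫ k, F k ∂uniformAngle = (Real.pi⁻¹ : ℝ) * ∫ k in (0 : ℝ)..Real.pi, F k := by
  have h := hper.intervalIntegral_add_eq Real.pi 0
  rw [zero_add, ← two_mul] at h
  rw [integral_uniformAngle_complex, ← intervalIntegral.integral_add_adjacent_intervals
    (hF.intervalIntegrable 0 Real.pi) (hF.intervalIntegrable Real.pi (2 * Real.pi)), h]
  have hpi : (Real.pi : ℂ) ≠ 0 := by exact_mod_cast Real.pi_pos.ne'
  push_cast
  field_simp
  ring

lemma speed_add_pi (k : ℝ) : speed (k + Real.pi) = -speed k := by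
  rw [speed, speed, Real.cos_add_pi, neg_sq, neg_div]

/-- Translation by `π` exchanges the two weights and reverses the speed. It only swaps the two
summands of the limiting overlap, whose powers are thus `π`-periodic. -/
lemma eigenWeight_add_pi (k : ℝ) : eigenWeight (k + Real.pi) = 1 - eigenWeight k := by
  rw [eigenWeight, eigenWeight, Real.cos_add_pi, Real.sin_add_pi, neg_sq, neg_div]
  ring

lemma continuous_eigenWeight : Continuous eigenWeight := by
  have h : ∀ k, Real.sqrt (1 + Real.cos k ^ 2) ≠ 0 := fun k =>
    (Real.sqrt_pos.2 (one_add_cos_sq_pos k)).ne'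
  exact (continuous_const.sub (Real.continuous_sin.div (by fun_prop) h)).div_const 2

/-- The square root in `𝒫` and `𝒬` yields `|sin k|`, which is `sin k` only on this half period.
Hence the reduction from `[0, 2π)` to `[0, π]`. -/
lemma eigenWeight_eq {k : ℝ} (hk : k ∈ Set.Icc 0 Real.pi) :
    eigenWeight k = weightQ (-speed k) ∧ 1 - eigenWeight k = weightP (-speed k) := by
  rw [weightQ, weightP, neg_sq, sqrt_one_sub_two_mul_speed_sq,
    abs_of_nonneg (Real.sin_nonneg_of_mem_Icc hk), eigenWeight]
  constructor
  · rfl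
  · ring

lemma charFun_limitA_eq {M : ℕ} (hM : 1 ≤ M) (θ : ℝ) :
    charFun (limitA M) θ
      = ∫ k, (eigenWeight k * Complex.exp ((θ / M : ℝ) * speed k * Complex.I) +
          (1 - eigenWeight k) * Complex.exp (-((θ / M : ℝ) * speed k * Complex.I))) ^ M
            ∂uniformAngle := by
  have h1 := continuous_eigenWeight
  have h2 := continuous_speed
  rw [(limitA_spec hM).2, integral_uniformAngle_of_periodic]
  · congr 1
    refine intervalIntegral.integral_congr fun k hk => ?_
    rw [Set.uIcc_of_le Real.pi_pos.le] at hk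
    rw [← (eigenWeight_eq hk).1, ← (eigenWeight_eq hk).2, add_comm]
    push_cast
    congr 4 <;> ring
  · fun_prop
  · intro k
    simp only
    rw [speed_add_pi, eigenWeight_add_pi, add_comm]
    push_cast
    congr 3
    · ring
    · ring_nf
    · ring_nf

lemma charFun_limitB_eq {M : ℕ} (hM : 1 ≤ M) (θ : ℝ) :
    charFun (limitB M) θ
      = ∫ k, (1 / 2 * Complex.exp ((θ / M : ℝ) * speed k * Complex.I) +
          1 / 2 * Complex.exp (-((θ / M : ℝ) * speed k * Complex.I))) ^ M ∂uniformAngle := by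
  have h2 := continuous_speed
  rw [(limitB_spec hM).2, integral_uniformAngle_of_periodic]
  · congr 1
    refine intervalIntegral.integral_congr fun k hk => ?_
    rw [add_comm]
    push_cast
    congr 4 <;> ring
  · fun_prop
  · intro k
    simp only
    rw [speed_add_pi, add_comm]
    push_cast
    congr 4 <;> ring

lemma tendsto_limitA {M : ℕ} (hM : 1 ≤ M) (hA : IsProbabilityMeasure (limitA M)) :
    Tendsto (fun d : ℕ => scaledLaw (positionA M (d * M)) ((d * M : ℕ) : ℝ)) atTop
      (𝓝 ⟨limitA M, hA⟩) := by
  refine ProbabilityMeasure.tendsto_of_tendsto_charFun fun θ => ?_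
  rw [ProbabilityMeasure.coe_mk, charFun_limitA_eq hM]
  simp only [charFun_positionA_eq]
  refine tendsto_integral_of_dominated_convergence (fun _ => 1)
    (fun d => ((continuous_overlap_add d phi0 _).pow M).aestronglyMeasurable)
    (integrable_const 1) (fun d => ae_of_all _ fun k => norm_pow_overlap_le_one d M _ _)
    (ae_of_all _ fun k => ?_)
  -- The increment `θ / (dM)` is read as `(θ/M) / d`, so the spectral limit applies with `c = θ/M`.
  refine ((tendsto_overlap k (θ / M)).congr fun d => ?_).pow M
  rw [Nat.cast_mul, div_div, mul_comm (M : ℝ)]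

lemma tendsto_limitB {M : ℕ} (hM : 1 ≤ M) (hB : IsProbabilityMeasure (limitB M)) :
    Tendsto (fun d : ℕ => scaledLaw (positionB M (d * M)) ((d * M : ℕ) : ℝ)) atTop
      (𝓝 ⟨limitB M, hB⟩) := by
  refine ProbabilityMeasure.tendsto_of_tendsto_charFun fun θ => ?_
  rw [ProbabilityMeasure.coe_mk, charFun_limitB_eq hM]
  simp only [charFun_positionB_eq]
  refine tendsto_integral_of_dominated_convergence (fun _ => 1)
    (fun d => ((continuous_meanOverlap_add d _).pow M).aestronglyMeasurable)
    (integrable_const 1) (fun d => ae_of_all _ fun k => norm_pow_meanOverlap_le_one d M _ _)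
    (ae_of_all _ fun k => ?_)
  refine ((tendsto_meanOverlap k (θ / M)).congr fun d => ?_).pow M
  rw [Nat.cast_mul, div_div, mul_comm (M : ℝ)]

end MultiCoin

theorem proposition2 :
    -- `M` fixed, `d → ∞`
    (∀ M : ℕ, 1 ≤ M →
      (∃ hA : IsProbabilityMeasure (MultiCoin.limitA M),
        Tendsto (fun d : ℕ => MultiCoin.scaledLaw (MultiCoin.positionA M (d * M))
          ((d * M : ℕ) : ℝ)) atTop (𝓝 ⟨MultiCoin.limitA M, hA⟩)) ∧
      (∃ hB : IsProbabilityMeasure (MultiCoin.limitB M),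
        Tendsto (fun d : ℕ => MultiCoin.scaledLaw (MultiCoin.positionB M (d * M))
          ((d * M : ℕ) : ℝ)) atTop (𝓝 ⟨MultiCoin.limitB M, hB⟩))) ∧
    -- `d ≥ 2` fixed, `M → ∞`
    (∀ d : ℕ, 2 ≤ d →
      (∀ k : ℝ, (MultiCoin.mu d k).im = 0) ∧
      (∀ k : ℝ, (MultiCoin.nu d k).im = 0 ∧ 0 ≤ (MultiCoin.nu d k).re) ∧
      (∃ Y : ProbabilityMeasure ℝ,
        (∀ x : ℝ, cdf (Y : Measure ℝ) x =
          ∫ _k in {k : ℝ | k ∈ Set.Ico 0 (2 * Real.pi) ∧ (MultiCoin.mu d k).re ≤ x},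
            1 / (2 * Real.pi)) ∧
        Tendsto (fun M : ℕ => MultiCoin.scaledLaw (MultiCoin.positionA M (d * M))
          ((d * M : ℕ) : ℝ)) atTop (𝓝 Y)) ∧
      (∃ Z : ProbabilityMeasure ℝ,
        (∀ x : ℝ, cdf (Z : Measure ℝ) x =
          ∫ p in {p : ℝ × ℝ | p.1 ∈ Set.Ico 0 (2 * Real.pi) ∧
              p.2 * Real.sqrt (MultiCoin.nu d p.1).re ≤ x},
            Real.exp (-p.2 ^ 2 / 2) / (2 * Real.pi) ^ (3 / 2 : ℝ)) ∧
        Tendsto (fun M : ℕ => MultiCoin.scaledLaw (MultiCoin.positionB M (d * M))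
          (Real.sqrt ((d * M : ℕ) : ℝ))) atTop (𝓝 Z))) := by
  refine ⟨fun M hM => ⟨⟨(MultiCoin.limitA_spec hM).1, MultiCoin.tendsto_limitA hM _⟩,
    (MultiCoin.limitB_spec hM).1, MultiCoin.tendsto_limitB hM _⟩, fun d hd => ?_⟩
  have hd0 : 0 < d := by omega
  exact ⟨MultiCoin.mu_im d, MultiCoin.nu_im_re d hd0,
    ⟨MultiCoin.driftLaw d, MultiCoin.cdf_driftLaw d, MultiCoin.tendsto_driftLaw d⟩,
    ⟨MultiCoin.mixtureLaw d, MultiCoin.cdf_mixtureLaw d, MultiCoin.tendsto_mixtureLaw d hd0⟩⟩
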